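/- **Noise robustness of ForestDSH.** Let $\mathcal A,\mathcal B$ be finite alphabets with $k,l\ge 2$ letters, let $P=[p_{ij}]$ be a probability distribution on $\mathcal A\times\mathcal B$ with all $p_{ij}>0$, with marginals $p_i^{\mathcal A},p_j^{\mathcal B}$, and put $q_{ij}=p_i^{\mathcal A}p_j^{\mathcal B}$. Fix $\delta\ge 0$. Let $\mathcal I$ be the set of $(\mu,\nu,\eta)\in\mathbb R^3$ with $\min(\mu,\nu)\ge\eta\ge0$ and $\sum_{i,j}p_{ij}^{1+\mu+\nu-\eta}(p_i^{\mathcal A})^{-\mu}(p_j^{\mathcal B})^{-\nu}=1$, and $$\lambda^*=\sup_{(\mu,\nu,\eta)\in\mathcal I}\frac{\max(1,\delta)+\mu+\nu\delta}{1+\mu+\nu-\eta},\qquad c_d=\min\left(\frac{\lambda^*-1}{\log\big(1/\max_{i,j}\frac{p_{ij}}{p_i^{\mathcal A}}\big)},\ \frac{\lambda^*-\delta}{\log\big(1/\max_{i,j}\frac{p_{ij}}{p_j^{\mathcal B}}\big)}\right).$$ Let $p_0=\prod_{i,j}p_{ij}$ and $q_0=\min\big(\prod_{i,j}q_{ij},\prod_i(p_i^{\mathcal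 A})^l,\prod_j(p_j^{\mathcal B})^k\big)$. *The tree.* For $N\ge2$ the decision tree $G=G_N$ is built from $P$ as follows. A node $v$ is a finite sequence of pairs $(a_i,b_j)$, with coordinate sequences $Seq^{\mathcal A}(v)$, $Seq^{\mathcal B}(v)$; $\Phi(v),\Psi^{\mathcal A}(v),\Psi^{\mathcal B}(v)$ are the products of $p_{ij}$, $p_i^{\mathcal A}$, $p_j^{\mathcal B}$ along it, and $\Psi=\Psi^{\mathcal A}\Psi^{\mathcal B}$. The root is branched into its $kl$ children. A created node $v$ becomes a bucket if $\Phi(v)/\Psi(v)\ge p_0q_0N^{1+\delta-\lambda^*}$; otherwise it is pruned if $\Phi(v)/\Psi^{\mathcal A}(v)\le p_0q_0N^{1-\lambda^*}$ or $\Phi(v)/\Psi^{\mathcal B}(v)\le p_0q_0N^{\delta-\lambda^*}$; otherwise it is branched into its $kl$ children. $V(G)$ is the set of all created nodes, including the root and the pruned nodes. *The search.* There are $N$ classes $x\in\mathcal A^S$, $M\le N^\delta$ queries $y\in\mathcal B^S$, and $b$ bands, each with a permutation of $\{1,\dots,S\}$. In band $z$, $H_z^{\mathcal A}(x)$ (resp.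 $H_z^{\mathcal B}(y)$) is the set of buckets $v$ such that $Seq^{\mathcal A}(v)$ (resp. $Seq^{\mathcal B}(v)$) is a prefix of the permuted point, and $(x,y)$ is called positive if $H_z^{\mathcal A}(x)\cap H_z^{\mathcal B}(y)\neq\varnothing$ for some $z$. With unit costs $c_{tree},c_{hash},c_{ins},c_{pos}\ge0$ the cost of a run is $$c_{tree}|V(G)|+c_{hash}\,b(N+M)+c_{ins}\sum_z\Big(\sum_x|H_z^{\mathcal A}(x)|+\sum_y|H_z^{\mathcal B}(y)|\Big)+c_{pos}\sum_z\sum_{x,y}|H_z^{\mathcal A}(x)\cap H_z^{\mathcal B}(y)| .$$ *The data.* Data are generated from $P'=[p'_{ij}]$ if every class, respectively query, has i.i.d. coordinates with the row, respectively column, marginal law of $P'$; each query has at most one true class among the $N$ classes, and together with it has i.i.d. coordinate pairs of law $P'$; and any other pair of a class and a query is independent. **Theorem.** Let $\epsilon>0$, $TP<1$, and let the unit costs be given. There is a constant $K$, depending only on $P,\delta,\epsilon,TP$ and the unit costs, such that for every $N\ge2$ the tree $G_N$ is finite and there is a number of bands $b$ such that for every $S\ge b\cdot\mathrm{depth}(G_N)$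 there are permutations for the $b$ bands with the following property. For every probability distribution $P'$ with $\frac{p_{ij}}{1+\epsilon}\le p'_{ij}\le p_{ij}(1+\epsilon)$ for all $i,j$, every $M\le N^\delta$ and all data generated from $P'$, each pair of a query and its true class is called positive with probability at least $TP$, and the expected cost of the run is at most $$K\,N^{\lambda^*+3c_d\log(1+\epsilon)} .$$ -/

import Mathlib

open scoped BigOperators

noncomputable section

namespace ForestDSH

variable {A B : Type*} [Fintype A] [Fintype B]

/-! ### The one-letter distribution and the parameters derived from it -/

/-- Row marginal `p_i^A`. -/
def margA (p : A → B → ℝ) (i : A) : ℝ := ∑ j, p i j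

/-- Column marginal `p_j^B`. -/
def margB (p : A → B → ℝ) (j : B) : ℝ := ∑ i, p i j

/-- The set `I` of triples `(μ, ν, η)` with `min μ ν ≥ η ≥ 0` and
`∑ p_ij ^ (1+μ+ν-η) (p_i^A) ^ (-μ) (p_j^B) ^ (-ν) = 1`. -/
def multiplierSet (p : A → B → ℝ) : Set (ℝ × ℝ × ℝ) :=
  {t | t.2.2 ≤ min t.1 t.2.1 ∧ 0 ≤ t.2.2 ∧
    ∑ i, ∑ j, (p i j) ^ (1 + t.1 + t.2.1 - t.2.2) *
      (margA p i) ^ (-t.1) * (margB p j) ^ (-t.2.1) = 1}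

/-- The exponent `λ*`: the largest value (in general, the supremum) over `I` of
`(max 1 δ + μ + ν δ) / (1 + μ + ν - η)`. -/
def lamStar (p : A → B → ℝ) (δ : ℝ) : ℝ :=
  sSup ((fun t : ℝ × ℝ × ℝ =>
    (max 1 δ + t.1 + t.2.1 * δ) / (1 + t.1 + t.2.1 - t.2.2)) '' multiplierSet p)

/-- `p₀ = ∏ p_ij`. -/
def pZero (p : A → B → ℝ) : ℝ := ∏ i, ∏ j, p i j

/-- `q₀ = min (∏ q_ij, ∏ (p_i^A)^l, ∏ (p_j^B)^k)`, where `q_ij = p_i^A p_j^B`, `k = |A|`, `l = |B|`. -/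
def qZero (p : A → B → ℝ) : ℝ :=
  min (∏ i, ∏ j, margA p i * margB p j)
    (min (∏ i, margA p i ^ Fintype.card B) (∏ j, margB p j ^ Fintype.card A))

/-- The depth constant
`c_d = min ((λ* - 1) / log (1 / max p_ij/p_i^A), (λ* - δ) / log (1 / max p_ij/p_j^B))`. -/
def depthConst (p : A → B → ℝ) (δ : ℝ) : ℝ :=
  min ((lamStar p δ - 1) / Real.log (1 / ⨆ e : A × B, p e.1 e.2 / margA p e.1))
    ((lamStar p δ - δ) / Real.log (1 / ⨆ e : A × B, p e.1 e.2 / margB p e.2))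

/-! ### The decision tree

A node is identified with the list of edge labels `(a, b)` on the path from the root to it, so that
`Seq^A` and `Seq^B` of a node are its two coordinate lists. -/

/-- `Φ(v)`. -/
def Phi (p : A → B → ℝ) (v : List (A × B)) : ℝ := (v.map fun e => p e.1 e.2).prod

/-- `Ψ^A(v)`. -/
def PsiA (p : A → B → ℝ) (v : List (A × B)) : ℝ := (v.map fun e => margA p e.1).prod

/-- `Ψ^B(v)`. -/
def PsiB (p : A → B → ℝ) (v : List (A × B)) : ℝ := (v.map fun e => margB p e.2).prod

/-- `Ψ(v) = Ψ^A(v) Ψ^B(v)`. -/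
def Psi (p : A → B → ℝ) (v : List (A × B)) : ℝ := PsiA p v * PsiB p v

/-- The rule by which a node becomes a bucket (with `C₁ = p₀ q₀`). -/
def Accepts (p : A → B → ℝ) (δ : ℝ) (N : ℕ) (v : List (A × B)) : Prop :=
  pZero p * qZero p * (N : ℝ) ^ (1 + δ - lamStar p δ) ≤ Phi p v / Psi p v

/-- The rule by which a node that is not accepted is pruned (with `C₂ = C₃ = p₀ q₀`). -/
def Prunes (p : A → B → ℝ) (δ : ℝ) (N : ℕ) (v : List (A × B)) : Prop :=
  Phi p v / PsiA p v ≤ pZero p * qZero p * (N : ℝ) ^ (1 - lamStar p δ) ∨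
    Phi p v / PsiB p v ≤ pZero p * qZero p * (N : ℝ) ^ (δ - lamStar p δ)

/-- The nodes which the construction branches into their `k l` children: the root, and every created
node that is neither accepted nor pruned. -/
inductive Branches (p : A → B → ℝ) (δ : ℝ) (N : ℕ) : List (A × B) → Prop
  | root : Branches p δ N []
  | step (v : List (A × B)) (e : A × B) (hv : Branches p δ N v)
      (hacc : ¬ Accepts p δ N (v ++ [e])) (hpru : ¬ Prunes p δ N (v ++ [e])) :
      Branches p δ N (v ++ [e])

/-- The nodes `V(G)` of the tree: the root and all children of branching nodes (pruned ones
included). -/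
def treeNodes (p : A → B → ℝ) (δ : ℝ) (N : ℕ) : Set (List (A × B)) :=
  {v | v = [] ∨ ∃ u e, Branches p δ N u ∧ v = u ++ [e]}

/-- The buckets: the accepted children of branching nodes. -/
def treeBuckets (p : A → B → ℝ) (δ : ℝ) (N : ℕ) : Set (List (A × B)) :=
  {v | ∃ u e, Branches p δ N u ∧ v = u ++ [e] ∧ Accepts p δ N v}

/-- The depth of the tree. -/
def treeDepth (p : A → B → ℝ) (δ : ℝ) (N : ℕ) : ℕ := sSup (List.length '' treeNodes p δ N)

/-! ### Hashing and search -/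

/-- `H_z^A(x)`: the buckets `v` (in the set `W`) for which `Seq^A(v)` is a prefix of the permuted
point `(x_{σ(1)}, …, x_{σ(S)})`. -/
def hashA {S : ℕ} (W : Set (List (A × B))) (σ : Equiv.Perm (Fin S)) (x : Fin S → A) :
    Set (List (A × B)) :=
  {v | v ∈ W ∧ v.map Prod.fst <+: List.ofFn (fun s => x (σ s))}

/-- `H_z^B(y)`. -/
def hashB {S : ℕ} (W : Set (List (A × B))) (σ : Equiv.Perm (Fin S)) (y : Fin S → B) :
    Set (List (A × B)) :=
  {v | v ∈ W ∧ v.map Prod.snd <+: List.ofFn (fun s => y (σ s))}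

/-- `(x, y)` is called positive: in at least one band the two points share a bucket. -/
def CalledPositive {S b : ℕ} (W : Set (List (A × B))) (perm : Fin b → Equiv.Perm (Fin S))
    (x : Fin S → A) (y : Fin S → B) : Prop :=
  ∃ z, (hashA W (perm z) x ∩ hashB W (perm z) y).Nonempty

/-- `N` classes in `A^S` together with `M` queries in `B^S`. -/
abbrev DataSet (A B : Type*) (S N M : ℕ) := (Fin N → Fin S → A) × (Fin M → Fin S → B)

/-- The unit costs of creating a node, of one hash-table look-up, of one insertion into a bucket and
of checking one positive call. -/
structure UnitCosts where
  tree : ℝ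
  hash : ℝ
  insertion : ℝ
  pos : ℝ
  tree_nonneg : 0 ≤ tree
  hash_nonneg : 0 ≤ hash
  insertion_nonneg : 0 ≤ insertion
  pos_nonneg : 0 ≤ pos

/-- The cost of a run on the data `D` with `b` bands, for a tree with node set `V` and bucket set `W`:
building the tree, one look-up of every point in every band, one insertion for every bucket which a
point falls into, and one check for every common bucket of a class and a query in a band. -/
def runCost (c : UnitCosts) (V W : Set (List (A × B))) {S N M b : ℕ}
    (perm : Fin b → Equiv.Perm (Fin S)) (D : DataSet A B S N M) : ℝ :=
  c.tree * (V.ncard : ℝ) + c.hash * ((b : ℝ) * (N : ℝ) + (b : ℝ) * (M : ℝ)) +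
    c.insertion * ((∑ z, ∑ n, ((hashA W (perm z) (D.1 n)).ncard : ℝ)) +
      ∑ z, ∑ m, ((hashB W (perm z) (D.2 m)).ncard : ℝ)) +
    c.pos * ∑ z, ∑ n, ∑ m,
      ((hashA W (perm z) (D.1 n) ∩ hashB W (perm z) (D.2 m)).ncard : ℝ)

/-! ### The data -/

/-- Probability of an event under a probability mass function on data sets. -/
def prob {S N M : ℕ} (law : DataSet A B S N M → ℝ) (E : Set (DataSet A B S N M)) : ℝ :=
  ∑ D, E.indicator law D

/-- Expectation under a probability mass function on data sets. -/
def expect {S N M : ℕ} (law : DataSet A B S N M → ℝ) (f : DataSet A B S N M → ℝ) : ℝ :=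
  ∑ D, law D * f D

/-- `law` is the law of data generated from the one-letter distribution `p`: every class has law
`P^A`, every query has law `P^B`, a query and its true class (`partner m = some n`) have joint law
`P`, and every other pair of a class and a query has joint law `Q = P^A P^B`. A query without a true
class is allowed. -/
structure IsDataLaw {S N M : ℕ} (p : A → B → ℝ) (partner : Fin M → Option (Fin N))
    (law : DataSet A B S N M → ℝ) : Prop where
  nonneg : ∀ D, 0 ≤ law D
  sum_eq_one : ∑ D, law D = 1
  class_law : ∀ n x, prob law {D | D.1 n = x} = ∏ s, margA p (x s)
  query_law : ∀ m y, prob law {D | D.2 m = y} = ∏ s, margB p (y s)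
  true_pair_law : ∀ n m x y, partner m = some n →
    prob law {D | D.1 n = x ∧ D.2 m = y} = ∏ s, p (x s) (y s)
  random_pair_law : ∀ n m x y, partner m ≠ some n →
    prob law {D | D.1 n = x ∧ D.2 m = y} = ∏ s, (margA p (x s) * margB p (y s))

end ForestDSH

end

open scoped BigOperators

noncomputable section

namespace ForestDSH

/-! ### A theorem of the alternative for concave inequalities -/

/-! The tree rules compare letter sums of `logAB`, `logA`, `logB` along a node with multiples of
`log N`, so they are linear conditions on the type (the letter counts) of the node. Under `P` the
words of type `s log N` have total probability `N ^ (-relEntropy s)`, up to a factor polynomial in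
`log N`. The supremum defining `λ*` is the dual of minimising the relative entropy under these
linear conditions. Strong duality (Hahn–Banach separation and the Gibbs variational principle)
therefore yields a type that meets all thresholds with relative entropy at most `λ* - max 1 δ`
(`exists_optimal_type`). Every word of the rounded type runs into a bucket, so the total bucket mass
`α = ∑ Φ(v)` is at least a constant times `N ^ (max 1 δ - λ* - c_d κ)`, for any fixed `κ > 0`
(`exists_bucket_mass_ge`).

The rules also give the upper bounds. With `θ = p₀ · p₀ q₀`, nodes have `Φ ≥ θ N ^ (-λ*)` and leaves
are prefix-free, so there are `O(N ^ λ*)` nodes. Summed over the buckets, `Ψ^A`, `Ψ^B`, `Ψ` are at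
most `α / θ` times `N ^ (λ* - 1)`, `N ^ (λ* - δ)`, `N ^ (λ* - 1 - δ)`. Bands reading disjoint blocks
of coordinates are independent, and each finds a true pair with probability equal to the bucket
mass, so about `1 / α` bands suffice.

Nodes have length at most `c_d log N + O(1)`, hence replacing `P` by `P'` changes node weights by a
factor at most `R = (1 + ε) ^ depth = O(Q)`, where `Q = N ^ (c_d log (1 + ε))`. Taking about `R / α`
bands secures the true positive rate. With `κ = 2 log (1 + ε)`, hashing costs `O(N ^ λ* R Q ^ 2)`,
insertions `O(N ^ λ* R ^ 2)` and positive calls `O(N ^ λ* R ^ 3)`; all are `O(N ^ λ* Q ^ 3)`. -/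

/-- On `K` the pointwise minimum of the `g i` is continuous and attains a maximum, which is
negative; off `K` the gap is 1. A uniform gap is needed because separation from 0 alone would only
give multipliers with a nonstrict inequality. -/
theorem exists_gap_of_forall_exists_neg {V ι : Type*} [TopologicalSpace V] [Fintype ι] [Nonempty ι]
    {S K : Set V} {g : ι → V → ℝ} (hK : IsCompact K) (hKS : K ⊆ S) (hcont : ∀ i, Continuous (g i))
    (hout : ∀ s ∈ S, s ∉ K → ∃ i, g i s ≤ -1) (hneg : ∀ s ∈ S, ∃ i, g i s < 0) :
    ∃ ζ > 0, ∀ s ∈ S, ∃ i, g i s ≤ -ζ := by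
  classical
  have hne : (Finset.univ : Finset ι).Nonempty := Finset.univ_nonempty
  rcases K.eq_empty_or_nonempty with rfl | hKne
  · exact ⟨1, one_pos, fun s hs => hout s hs (Set.notMem_empty s)⟩
  have hc : ContinuousOn (fun s => Finset.univ.inf' hne fun i => g i s) K :=
    ContinuousOn.finset_inf'_apply hne fun i _ => (hcont i).continuousOn
  obtain ⟨s₀, hs₀, hmax⟩ := hK.exists_isMaxOn hKne hc
  obtain ⟨i₀, hi₀⟩ := hneg s₀ (hKS hs₀)
  have hm : (Finset.univ.inf' hne fun i => g i s₀) < 0 :=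
    (Finset.inf'_le _ (Finset.mem_univ i₀)).trans_lt hi₀
  refine ⟨min 1 (-(Finset.univ.inf' hne fun i => g i s₀)), lt_min one_pos (by linarith), ?_⟩
  intro s hs
  by_cases hsK : s ∈ K
  · obtain ⟨i, -, hi⟩ := Finset.exists_mem_eq_inf' hne fun i => g i s
    have h1 : (Finset.univ.inf' hne fun i => g i s) ≤ Finset.univ.inf' hne fun i => g i s₀ :=
      hmax hsK
    refine ⟨i, ?_⟩
    have := min_le_right 1 (-(Finset.univ.inf' hne fun i => g i s₀))
    rw [hi] at h1
    linarith
  · obtain ⟨i, hi⟩ := hout s hs hsK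
    refine ⟨i, ?_⟩
    have := min_le_left 1 (-(Finset.univ.inf' hne fun i => g i s₀))
    linarith

/-- The vectors lying strictly below some value vector `g s` form an open convex set that misses the
constant vector `-ζ`. The coordinates of a separating functional are the multipliers; they are
nonnegative because this set is closed downwards. -/
theorem exists_multipliers_of_gap {V ι : Type*} [AddCommGroup V] [Module ℝ V] [Fintype ι]
    {S : Set V} {g : ι → V → ℝ} (hSne : S.Nonempty) (hconc : ∀ i, ConcaveOn ℝ S (g i))
    {ζ : ℝ} (hζ : 0 < ζ) (hgap : ∀ s ∈ S, ∃ i, g i s ≤ -ζ) :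
    ∃ w : ι → ℝ, (∀ i, 0 ≤ w i) ∧ ∀ s ∈ S, ∑ i, w i * g i s < 0 := by
  classical
  obtain ⟨s₀, hs₀⟩ := hSne
  have hSconv : Convex ℝ S := by
    rcases isEmpty_or_nonempty ι with h | ⟨⟨i⟩⟩
    · obtain ⟨i, -⟩ := hgap s₀ hs₀
      exact (h.false i).elim
    · exact (hconc i).1
  let U : Set (ι → ℝ) := {u | ∃ s ∈ S, ∀ i, u i < g i s}
  have hUconv : Convex ℝ U := by
    rintro u ⟨s, hs, hu⟩ v ⟨t, ht, hv⟩ x y hx hy hxy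
    refine ⟨x • s + y • t, hSconv hs ht hx hy hxy, fun i => ?_⟩
    have h1 := (hconc i).2 hs ht hx hy hxy
    simp only [smul_eq_mul] at h1
    refine lt_of_lt_of_le ?_ h1
    simp only [Pi.add_apply, Pi.smul_apply, smul_eq_mul]
    rcases hx.eq_or_lt with rfl | hx'
    · have : y = 1 := by linarith
      subst this
      linarith [hv i]
    · have := mul_lt_mul_of_pos_left (hu i) hx'
      have := mul_le_mul_of_nonneg_left (hv i).le hy
      linarith
  have hUopen : IsOpen U := by
    have : U = ⋃ s ∈ S, Set.pi Set.univ fun i => Set.Iio (g i s) := by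
      ext u
      simp [U, Set.mem_pi]
    rw [this]
    exact isOpen_biUnion fun s _ => isOpen_set_pi Set.finite_univ fun i _ => isOpen_Iio
  have hnot : (fun _ => -ζ : ι → ℝ) ∉ U := by
    rintro ⟨s, hs, h⟩
    obtain ⟨i, hi⟩ := hgap s hs
    exact absurd (h i) (not_lt.2 hi)
  obtain ⟨f, hf⟩ := geometric_hahn_banach_open_point hUconv hUopen hnot
  have hfsum : ∀ u : ι → ℝ, f u = ∑ i, f (Pi.single i 1) * u i := by
    intro u
    conv_lhs => rw [pi_eq_sum_univ' u, map_sum]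
    refine Finset.sum_congr rfl fun i _ => ?_
    rw [map_smul, smul_eq_mul, mul_comm]
  set w : ι → ℝ := fun i => f (Pi.single i 1) with hw
  have hU : ∀ s ∈ S, ∀ u : ι → ℝ, (∀ i, u i < g i s) → ∑ i, w i * u i < ∑ i, w i * (-ζ) := by
    intro s hs u hu
    have := hf u ⟨s, hs, hu⟩
    rwa [hfsum u, hfsum fun _ => -ζ] at this
  have hwnn : ∀ i, 0 ≤ w i := by
    intro i
    by_contra hneg
    push Not at hneg
    set C : ℝ := ∑ j, w j * (g j s₀ - 1) - ∑ j, w j * (-ζ) with hC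
    -- Lowering coordinate `i` by `t` would raise the functional by `|C| + 1`, past the separating
    -- value.
    set t : ℝ := (|C| + 1) / (-w i) with ht
    have ht0 : 0 ≤ t := by
      apply div_nonneg (by positivity)
      linarith
    have := hU s₀ hs₀ (fun j => g j s₀ - 1 - (if j = i then t else 0)) (by
      intro j
      split_ifs <;> linarith)
    have h2 : ∑ j, w j * (g j s₀ - 1 - (if j = i then t else 0)) =
        ∑ j, w j * (g j s₀ - 1) - w i * t := by
      simp only [mul_sub, Finset.sum_sub_distrib, mul_ite, mul_zero, Finset.sum_ite_eq',
        Finset.mem_univ, if_true]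
    have h3 : w i * t = -(|C| + 1) := by
      rw [ht]
      field_simp
      rw [div_self hneg.ne]
    rw [h2, h3] at this
    linarith [neg_abs_le C]
  have hwsum : 0 < ∑ i, w i := by
    refine lt_of_le_of_ne (Finset.sum_nonneg fun i _ => hwnn i) fun h0 => ?_
    have hall : ∀ i, w i = 0 := fun i =>
      (Finset.sum_eq_zero_iff_of_nonneg fun i _ => hwnn i).1 h0.symm i (Finset.mem_univ i)
    have := hU s₀ hs₀ (fun j => g j s₀ - 1) fun j => by linarith
    simp [hall] at this
  refine ⟨w, hwnn, fun s hs => ?_⟩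
  have hle : ∀ r > 0, ∑ i, w i * g i s ≤ (∑ i, w i) * (-ζ) + (∑ i, w i) * r := by
    intro r hr
    have := hU s hs (fun j => g j s - r) fun j => by linarith
    simp only [mul_sub, Finset.sum_sub_distrib, ← Finset.sum_mul] at this
    linarith
  have := hle (ζ / 2) (by positivity)
  nlinarith

/-! ### Relative entropy of finite measures -/

/-- The relative entropy, homogeneous of degree one, of a finite measure with respect to `p`. -/
def relEntropy {E : Type*} [Fintype E] (p s : E → ℝ) : ℝ :=
  ∑ e, s e * Real.log (s e) - (∑ e, s e) * Real.log (∑ e, s e) - ∑ e, s e * Real.log (p e)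

theorem continuous_relEntropy {E : Type*} [Fintype E] (p : E → ℝ) :
    Continuous (relEntropy p) := by
  unfold relEntropy
  refine (Continuous.sub (continuous_finsetSum _ fun e _ => ?_) ?_).sub
    (continuous_finsetSum _ fun e _ => (continuous_apply e).mul continuous_const)
  · exact Real.continuous_mul_log.comp (continuous_apply e)
  · exact Real.continuous_mul_log.comp (continuous_finsetSum _ fun e _ => continuous_apply e)

theorem relEntropy_smul {E : Type*} [Fintype E] (p : E → ℝ) {t : ℝ} (ht : 0 ≤ t) (s : E → ℝ) :
    relEntropy p (t • s) = t * relEntropy p s := by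
  have key : ∀ x : ℝ, t * x * Real.log (t * x) = t * (x * Real.log x) + t * Real.log t * x := by
    intro x
    rcases ht.eq_or_lt with rfl | ht
    · simp
    rcases eq_or_ne x 0 with rfl | hx
    · simp
    rw [Real.log_mul ht.ne' hx]
    ring
  simp only [relEntropy, Pi.smul_apply, smul_eq_mul, ← Finset.mul_sum, key, Finset.sum_add_distrib,
    mul_assoc t]
  ring

/-- The left side is the tangent plane of the convex function `x log (x / X)` along the ray `x = r
X`; the bound is `log y ≤ y - 1` at `y = r X / x`. -/
theorem mul_log_ge_affine {x X r : ℝ} (hx : 0 ≤ x) (hxX : x ≤ X) (hr : 0 < r) :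
    x * Real.log r + x - r * X ≤ x * Real.log x - x * Real.log X := by
  rcases hx.eq_or_lt with rfl | hx
  · simp only [zero_mul, zero_add, zero_sub, sub_zero]
    have := mul_nonneg hr.le hxX
    linarith
  · have hX : 0 < X := hx.trans_le hxX
    have h1 := Real.log_le_sub_one_of_pos (show 0 < r * X / x by positivity)
    rw [Real.log_div (by positivity) hx.ne', Real.log_mul hr.ne' hX.ne'] at h1
    have h2 := mul_le_mul_of_nonneg_left h1 hx.le
    have h3 : x * (r * X / x - 1) = r * X - x := by field_simp
    rw [h3] at h2
    linarith

/-- Add the two tangent bounds with the common ratio `r = (x + y) / (X + Y)`, for which the affine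
corrections cancel. -/
theorem log_sum_inequality {x y X Y : ℝ} (hx : 0 ≤ x) (hy : 0 ≤ y) (hX : x ≤ X) (hY : y ≤ Y) :
    (x + y) * Real.log (x + y) - (x + y) * Real.log (X + Y) ≤
      (x * Real.log x - x * Real.log X) + (y * Real.log y - y * Real.log Y) := by
  rcases (add_nonneg hx hy).eq_or_lt with h | h
  · have hx0 : x = 0 := by linarith
    have hy0 : y = 0 := by linarith
    simp [hx0, hy0]
  · have hXY : 0 < X + Y := by linarith
    have h1 := mul_log_ge_affine hx hX (div_pos h hXY)
    have h2 := mul_log_ge_affine hy hY (div_pos h hXY)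
    rw [Real.log_div h.ne' hXY.ne'] at h1 h2
    have h3 : (x + y) / (X + Y) * X + (x + y) / (X + Y) * Y = x + y := by
      field_simp
    linarith

/-- The log-sum inequality in each coordinate, with `X` and `Y` the total masses. Together with
homogeneity, subadditivity is convexity. -/
theorem relEntropy_add_le {E : Type*} [Fintype E] (p : E → ℝ) {s t : E → ℝ}
    (hs : ∀ e, 0 ≤ s e) (ht : ∀ e, 0 ≤ t e) :
    relEntropy p (s + t) ≤ relEntropy p s + relEntropy p t := by
  have h := Finset.sum_le_sum fun e (_ : e ∈ (Finset.univ : Finset E)) =>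
    log_sum_inequality (hs e) (ht e)
      (Finset.single_le_sum (fun i _ => hs i) (Finset.mem_univ e))
      (Finset.single_le_sum (fun i _ => ht i) (Finset.mem_univ e))
  simp only [Finset.sum_sub_distrib, Finset.sum_add_distrib, ← Finset.sum_mul] at h
  simp only [relEntropy, Pi.add_apply, add_mul, Finset.sum_add_distrib] at h ⊢
  linarith

theorem convexOn_relEntropy {E : Type*} [Fintype E] (p : E → ℝ) :
    ConvexOn ℝ {s : E → ℝ | ∀ e, 0 ≤ s e} (relEntropy p) := by
  refine ⟨?_, ?_⟩
  · intro s hs t ht a b ha hb _ e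
    exact add_nonneg (mul_nonneg ha (hs e)) (mul_nonneg hb (ht e))
  · intro s hs t ht a b ha hb _
    refine (relEntropy_add_le p (s := a • s) (t := b • t) (fun e => mul_nonneg ha (hs e))
      fun e => mul_nonneg hb (ht e)).trans ?_
    rw [relEntropy_smul p ha, relEntropy_smul p hb, smul_eq_mul, smul_eq_mul]

/-- The Gibbs variational principle: a linear functional dominated by `τ` times the relative
entropy has exponential moment at most one. -/
theorem sum_mul_exp_le_one {E : Type*} [Fintype E] {p h : E → ℝ} (hp : ∀ e, 0 < p e) {τ : ℝ}
    (hτ : 0 < τ) (hdom : ∀ s : E → ℝ, (∀ e, 0 ≤ s e) → ∑ e, s e * h e ≤ τ * relEntropy p s) :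
    ∑ e, p e * Real.exp (h e / τ) ≤ 1 := by
  set F : ℝ := ∑ e, p e * Real.exp (h e / τ) with hF
  by_contra hlt
  push Not at hlt
  have hpos : ∀ e, 0 < p e * Real.exp (h e / τ) := fun e => mul_pos (hp e) (Real.exp_pos _)
  -- Testing at the exponentially tilted measure, the extremal one, leaves `τ F log F ≤ 0`, which
  -- excludes `F > 1`.
  have h1 := hdom (fun e => p e * Real.exp (h e / τ)) fun e => (hpos e).le
  have h2 : relEntropy p (fun e => p e * Real.exp (h e / τ)) =
      (∑ e, p e * Real.exp (h e / τ) * h e) / τ - F * Real.log F := by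
    simp only [relEntropy, Finset.sum_div]
    rw [← hF, sub_right_comm, ← Finset.sum_sub_distrib]
    congr 1
    refine Finset.sum_congr rfl fun e _ => ?_
    rw [Real.log_mul (hp e).ne' (Real.exp_ne_zero _), Real.log_exp]
    ring
  rw [h2, mul_sub, mul_div_cancel₀ _ hτ.ne'] at h1
  have : 0 < τ * (F * Real.log F) := mul_pos hτ (mul_pos (by linarith) (Real.log_pos hlt))
  linarith

/-- Strong duality for the relative entropy under three linear constraints. -/
theorem exists_relEntropy_le_of_dual {E : Type*} [Fintype E] {p X Y Z : E → ℝ}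
    (hp : ∀ e, 0 < p e) (hp1 : ∑ e, p e = 1) (hX : ∀ e, X e < 0) {a b c D : ℝ}
    (hdual : ∀ η μ ν : ℝ, 0 ≤ η → 0 ≤ μ → 0 ≤ ν →
      ∑ e, p e * Real.exp (η * Z e + μ * X e + ν * Y e) ≤ 1 → η * c - μ * a - ν * b ≤ D) :
    ∃ s : E → ℝ, (∀ e, 0 ≤ s e) ∧ c ≤ ∑ e, s e * Z e ∧ -a ≤ ∑ e, s e * X e ∧
      -b ≤ ∑ e, s e * Y e ∧ relEntropy p s ≤ D := by
  classical
  by_contra hno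
  set S : Set (E → ℝ) := {s | ∀ e, 0 ≤ s e} with hS
  have hlin : ∀ W : E → ℝ, Continuous fun s : E → ℝ => ∑ e, s e * W e := fun W =>
    continuous_finsetSum _ fun e _ => (continuous_apply e).mul continuous_const
  have hSconv : Convex ℝ S := (convexOn_relEntropy p).1
  have hlinc : ∀ (W : E → ℝ) (k : ℝ), ConcaveOn ℝ S fun s : E → ℝ => ∑ e, s e * W e + k := by
    intro W k
    refine ⟨hSconv, fun s _ t _ x y _ _ hxy => le_of_eq ?_⟩
    simp only [smul_eq_mul, Pi.add_apply, Pi.smul_apply, add_mul, Finset.sum_add_distrib, mul_add,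
      Finset.mul_sum, mul_assoc]
    have : k = x * k + y * k := by rw [← add_mul, hxy, one_mul]
    linarith
  let g : Fin 4 → (E → ℝ) → ℝ := ![fun s => ∑ e, s e * Z e + -c, fun s => ∑ e, s e * X e + a,
    fun s => ∑ e, s e * Y e + b, fun s => D - relEntropy p s]
  have hcont : ∀ i, Continuous (g i) := by
    intro i
    fin_cases i
    · exact (hlin Z).add continuous_const
    · exact (hlin X).add continuous_const
    · exact (hlin Y).add continuous_const
    · exact continuous_const.sub (continuous_relEntropy p)
  have hconc : ∀ i, ConcaveOn ℝ S (g i) := by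
    intro i
    fin_cases i
    · exact hlinc Z _
    · exact hlinc X _
    · exact hlinc Y _
    · exact (concaveOn_const D hSconv).sub (convexOn_relEntropy p)
  have hneg : ∀ s ∈ S, ∃ i, g i s < 0 := by
    intro s hs
    by_contra hall
    push Not at hall
    refine hno ⟨s, hs, ?_, ?_, ?_, ?_⟩
    · have : 0 ≤ ∑ e, s e * Z e + -c := hall 0
      linarith
    · have : 0 ≤ ∑ e, s e * X e + a := hall 1
      linarith
    · have : 0 ≤ ∑ e, s e * Y e + b := hall 2
      linarith
    · have : 0 ≤ D - relEntropy p s := hall 3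
      linarith
  -- Since every `X e` is negative, a lower bound on `∑ s e * X e` bounds each coordinate of `s`;
  -- off `K` the second constraint already fails by 1.
  set K : Set (E → ℝ) := {s | s ∈ S ∧ -a - 1 ≤ ∑ e, s e * X e} with hKdef
  have hKcpt : IsCompact K := by
    have hclosed : IsClosed K := by
      refine IsClosed.inter ?_ (isClosed_le continuous_const (hlin X))
      have : S = ⋂ e, {s : E → ℝ | 0 ≤ s e} := by
        ext s
        simp [S]
      rw [this]
      exact isClosed_iInter fun e => isClosed_le continuous_const (continuous_apply e)
    refine IsCompact.of_isClosed_subset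
      (isCompact_univ_pi fun e => isCompact_Icc (a := (0 : ℝ)) (b := (a + 1) / (-X e))) hclosed ?_
    rintro s ⟨hs, hsX⟩ e -
    refine ⟨hs e, ?_⟩
    rw [le_div_iff₀ (by linarith [hX e])]
    have h1 : ∑ e, s e * X e ≤ s e * X e := by
      rw [← Finset.add_sum_erase _ _ (Finset.mem_univ e)]
      have := Finset.sum_nonpos fun i (_ : i ∈ Finset.univ.erase e) =>
        mul_nonpos_of_nonneg_of_nonpos (hs i) (hX i).le
      linarith
    linarith
  have hout : ∀ s ∈ S, s ∉ K → ∃ i, g i s ≤ -1 := by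
    intro s hs hsK
    refine ⟨1, ?_⟩
    have : ¬ (-a - 1 ≤ ∑ e, s e * X e) := fun h => hsK ⟨hs, h⟩
    change ∑ e, s e * X e + a ≤ -1
    linarith
  obtain ⟨ζ, hζ, hgap⟩ := exists_gap_of_forall_exists_neg hKcpt (fun s hs => hs.1) hcont hout hneg
  have h0S : (0 : E → ℝ) ∈ S := fun e => le_rfl
  obtain ⟨w, hw, hwneg⟩ := exists_multipliers_of_gap ⟨0, h0S⟩ hconc hζ hgap
  have hwneg' : ∀ s ∈ S, ∑ e, s e * (w 0 * Z e + w 1 * X e + w 2 * Y e) - w 3 * relEntropy p s <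
      w 0 * c - w 1 * a - w 2 * b - w 3 * D := by
    intro s hs
    have h := hwneg s hs
    rw [Fin.sum_univ_four] at h
    change w 0 * (∑ e, s e * Z e + -c) + w 1 * (∑ e, s e * X e + a) +
      w 2 * (∑ e, s e * Y e + b) + w 3 * (D - relEntropy p s) < 0 at h
    have h2 : ∑ e, s e * (w 0 * Z e + w 1 * X e + w 2 * Y e) =
        w 0 * ∑ e, s e * Z e + w 1 * ∑ e, s e * X e + w 2 * ∑ e, s e * Y e := by
      simp only [Finset.mul_sum, ← Finset.sum_add_distrib]
      exact Finset.sum_congr rfl fun e _ => by ring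
    rw [h2]
    linarith
  set H : E → ℝ := fun e => w 0 * Z e + w 1 * X e + w 2 * Y e with hH
  set G : ℝ := w 0 * c - w 1 * a - w 2 * b - w 3 * D with hG
  have hG0 : 0 < G := by
    have := hwneg' 0 h0S
    simpa [relEntropy] using this
  -- The left side of `hwneg'` is homogeneous of degree one in `s`. A positive value `d` could be
  -- scaled to equal `G`, contradicting the strict bound.
  have hdom : ∀ s : E → ℝ, (∀ e, 0 ≤ s e) → ∑ e, s e * H e ≤ w 3 * relEntropy p s := by
    intro s hs
    by_contra hlt
    push Not at hlt
    set d : ℝ := ∑ e, s e * H e - w 3 * relEntropy p s with hd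
    have hd0 : 0 < d := by linarith
    have ht : 0 ≤ G / d := by positivity
    have h := hwneg' ((G / d) • s) fun e => mul_nonneg ht (hs e)
    rw [relEntropy_smul p ht] at h
    simp only [Pi.smul_apply, smul_eq_mul, mul_assoc, ← Finset.mul_sum] at h
    have h3 : G / d * ∑ e, s e * H e - w 3 * (G / d * relEntropy p s) = G := by
      rw [show G / d * ∑ e, s e * H e - w 3 * (G / d * relEntropy p s) = G / d * d by
        rw [hd]; ring]
      field_simp
    simp only [hH] at h3
    linarith
  -- If the entropy has multiplier zero, then `H ≤ 0` pointwise and every multiple `T w` is dual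
  -- feasible, with value `T G` exceeding `D` for large `T`. Otherwise division by `w 3` gives a
  -- feasible point, by the Gibbs principle, of value `D + G / w 3 > D`.
  rcases (hw 3).eq_or_lt with h3 | h3
  · have hHle : ∀ e, H e ≤ 0 := by
      intro e
      have := hdom (Pi.single e 1) fun i => by
        by_cases h : i = e
        · subst h; simp
        · simp [h]
      simpa [← h3, Pi.single_apply] using this
    set T : ℝ := (|D| + 1) / G with hT
    have hT0 : 0 ≤ T := by positivity
    have := hdual (T * w 0) (T * w 1) (T * w 2) (mul_nonneg hT0 (hw 0)) (mul_nonneg hT0 (hw 1))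
      (mul_nonneg hT0 (hw 2)) (by
        rw [← hp1]
        refine Finset.sum_le_sum fun e _ => ?_
        refine mul_le_of_le_one_right (hp e).le (Real.exp_le_one_iff.2 ?_)
        have := mul_nonpos_of_nonneg_of_nonpos hT0 (hHle e)
        simp only [hH] at this
        linarith)
    have h4 : T * w 0 * c - T * w 1 * a - T * w 2 * b = T * G := by
      rw [hG, ← h3]
      ring
    have h5 : T * G = |D| + 1 := by
      rw [hT]
      field_simp
    linarith [le_abs_self D]
  · have h1 := sum_mul_exp_le_one hp h3 hdom
    have := hdual (w 0 / w 3) (w 1 / w 3) (w 2 / w 3) (div_nonneg (hw 0) h3.le)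
      (div_nonneg (hw 1) h3.le) (div_nonneg (hw 2) h3.le) (by
        refine le_trans (le_of_eq ?_) h1
        refine Finset.sum_congr rfl fun e _ => ?_
        congr 2
        simp only [hH]
        ring)
    have h4 : w 0 / w 3 * c - w 1 / w 3 * a - w 2 / w 3 * b = G / w 3 + D := by
      rw [hG]
      field_simp
      ring
    have := div_pos hG0 h3
    linarith

/-! ### Products of one-letter weights over words -/

theorem sum_prod_word {α : Type*} [Fintype α] (f : α → ℝ) (n : ℕ) :
    ∑ u : Fin n → α, ∏ i, f (u i) = (∑ x, f x) ^ n := by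
  classical
  have := Finset.prod_univ_sum (fun _ : Fin n => (Finset.univ : Finset α)) fun _ x => f x
  rw [Fintype.piFinset_univ] at this
  rw [← this, Finset.prod_const, Finset.card_univ, Fintype.card_fin]

theorem sum_word_succ {α : Type*} [Fintype α] {n : ℕ} (F : (Fin (n + 1) → α) → ℝ) :
    ∑ u, F u = ∑ x, ∑ u : Fin n → α, F (Fin.cons x u) := by
  rw [← Fintype.sum_prod_type', ← (Fin.consEquiv fun _ : Fin (n + 1) => α).sum_comp]
  rfl

open Classical in
/-- The probability that a random word extends the word `v`. -/
theorem sum_prefix_weight {α : Type*} [Fintype α] {f : α → ℝ} (hf1 : ∑ x, f x = 1) (n : ℕ)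
    (v : List α) :
    ∑ u : Fin n → α, (if v <+: List.ofFn u then ∏ i, f (u i) else 0) =
      if v.length ≤ n then (v.map f).prod else 0 := by
  induction n generalizing v with
  | zero =>
    cases v with
    | nil => simp
    | cons a v => simp
  | succ n ih =>
    cases v with
    | nil =>
      simp [sum_prod_word, hf1]
    | cons a v =>
      rw [sum_word_succ]
      have h : ∀ (x : α) (u : Fin n → α),
          (if a :: v <+: List.ofFn (Fin.cons x u : Fin (n + 1) → α) then
            ∏ i, f ((Fin.cons x u : Fin (n + 1) → α) i) else 0) =
          if x = a then f x * (if v <+: List.ofFn u then ∏ i, f (u i) else 0) else 0 := by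
        intro x u
        rw [List.ofFn_succ, Fin.prod_univ_succ]
        simp only [Fin.cons_zero, Fin.cons_succ, List.cons_prefix_cons]
        by_cases hx : x = a
        · subst hx; simp
        · simp [hx, Ne.symm hx]
      simp only [h]
      rw [Finset.sum_eq_single a]
      · simp only [if_true]
        rw [← Finset.mul_sum, ih]
        simp
      · intro x _ hx
        simp [hx]
      · simp

open Classical in
theorem sum_prefix_weight_perm {α : Type*} [Fintype α] {f : α → ℝ} (hf1 : ∑ x, f x = 1) {n : ℕ}
    (σ : Equiv.Perm (Fin n)) (v : List α) :
    ∑ u : Fin n → α, (if v <+: List.ofFn (fun s => u (σ s)) then ∏ i, f (u i) else 0) =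
      if v.length ≤ n then (v.map f).prod else 0 := by
  rw [← sum_prefix_weight hf1 n v, ← (Equiv.arrowCongr σ (Equiv.refl α)).sum_comp]
  refine Finset.sum_congr rfl fun u _ => ?_
  have h1 : (fun s => (Equiv.arrowCongr σ (Equiv.refl α)) u (σ s)) = u := by
    ext s
    simp
  have h2 : ∏ i, f ((Equiv.arrowCongr σ (Equiv.refl α)) u i) = ∏ i, f (u i) := by
    rw [← Equiv.prod_comp σ]
    simp
  rw [h1, h2]

open Classical in
-- Union bound. Elements longer than `n` are never prefixes, so no length restriction is needed.
theorem sum_exists_prefix_le {α : Type*} [Fintype α] {f : α → ℝ} (hf0 : ∀ x, 0 ≤ f x)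
    (hf1 : ∑ x, f x = 1) (n : ℕ) (W : Finset (List α)) :
    ∑ u : Fin n → α, (if ∃ v ∈ W, v <+: List.ofFn u then ∏ i, f (u i) else 0) ≤
      ∑ v ∈ W, (v.map f).prod := by
  have hprod : ∀ u : Fin n → α, 0 ≤ ∏ i, f (u i) := fun u => Finset.prod_nonneg fun i _ => hf0 _
  calc ∑ u : Fin n → α, (if ∃ v ∈ W, v <+: List.ofFn u then ∏ i, f (u i) else 0)
      ≤ ∑ u : Fin n → α, ∑ v ∈ W, (if v <+: List.ofFn u then ∏ i, f (u i) else 0) := by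
        refine Finset.sum_le_sum fun u _ => ?_
        have hnn : ∀ v ∈ W, 0 ≤ (if v <+: List.ofFn u then ∏ i, f (u i) else 0) := fun v _ => by
          split_ifs
          exacts [hprod u, le_rfl]
        split_ifs with h
        · obtain ⟨v, hv, hvu⟩ := h
          have := Finset.single_le_sum hnn hv
          rwa [if_pos hvu] at this
        · exact Finset.sum_nonneg hnn
    _ = ∑ v ∈ W, if v.length ≤ n then (v.map f).prod else 0 := by
        rw [Finset.sum_comm]
        exact Finset.sum_congr rfl fun v _ => sum_prefix_weight hf1 n v
    _ ≤ ∑ v ∈ W, (v.map f).prod := by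
        refine Finset.sum_le_sum fun v _ => ?_
        split_ifs
        · exact le_rfl
        · refine List.prod_nonneg fun x hx => ?_
          obtain ⟨y, -, rfl⟩ := List.mem_map.1 hx
          exact hf0 y

open Classical in
-- Two prefixes of one word are comparable, so a prefix-free set has disjoint cylinders and the
-- union bound is exact.
theorem sum_exists_prefix_eq {α : Type*} [Fintype α] {f : α → ℝ}
    (hf1 : ∑ x, f x = 1) {n : ℕ} {W : Finset (List α)} (hlen : ∀ v ∈ W, v.length ≤ n)
    (hW : ∀ v ∈ W, ∀ w ∈ W, v <+: w → v = w) :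
    ∑ u : Fin n → α, (if ∃ v ∈ W, v <+: List.ofFn u then ∏ i, f (u i) else 0) =
      ∑ v ∈ W, (v.map f).prod := by
  have h : ∀ u : Fin n → α, (if ∃ v ∈ W, v <+: List.ofFn u then ∏ i, f (u i) else 0) =
      ∑ v ∈ W, (if v <+: List.ofFn u then ∏ i, f (u i) else 0) := by
    intro u
    split_ifs with h
    · obtain ⟨v, hv, hvu⟩ := h
      rw [Finset.sum_eq_single v, if_pos hvu]
      · intro w hw hwv
        refine if_neg fun hwu => hwv ?_
        rcases List.prefix_or_prefix_of_prefix hwu hvu with h | h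
        · exact hW w hw v hv h
        · exact (hW v hv w hw h).symm
      · exact fun h => absurd hv h
    · push Not at h
      exact (Finset.sum_eq_zero fun v hv => if_neg (h v hv)).symm
  simp only [h]
  rw [Finset.sum_comm]
  refine Finset.sum_congr rfl fun v hv => ?_
  rw [sum_prefix_weight hf1 n v, if_pos (hlen v hv)]

/-! ### The probability of a type class -/

open Classical in
/-- The number of words with prescribed letter counts is the multinomial coefficient. -/
theorem card_words_with_counts_mul {α : Type*} [Fintype α] (n : ℕ) (k : α → ℕ)
    (hk : ∑ x, k x = n) :
    (∑ u : Fin n → α, (if (fun x => (List.ofFn u).count x) = k then (1 : ℝ) else 0)) *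
      ∏ x, ((k x).factorial : ℝ) = n.factorial := by
  induction n generalizing k with
  | zero =>
    have : k = 0 := by
      ext x
      simpa using (Finset.sum_eq_zero_iff.1 hk) x (Finset.mem_univ x)
    subst this
    simp
    rfl
  | succ n ih =>
    rw [sum_word_succ]
    -- Split by the first letter `x`: the tail then has counts `k` lowered by one at `x`. Summing `k
    -- x * n!` over `x` gives `(n + 1)!`.
    have hstep : ∀ x : α, (∑ u : Fin n → α,
        (if (fun y => (List.ofFn (Fin.cons x u : Fin (n + 1) → α)).count y) = k
          then (1 : ℝ) else 0)) * ∏ y, ((k y).factorial : ℝ) = k x * n.factorial := by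
      intro x
      have hcount : ∀ (u : Fin n → α) (y : α),
          (List.ofFn (Fin.cons x u : Fin (n + 1) → α)).count y =
            (List.ofFn u).count y + if x = y then 1 else 0 := by
        intro u y
        rw [List.ofFn_succ]
        simp [List.count_cons]
      rcases Nat.eq_zero_or_pos (k x) with h0 | hpos
      · rw [h0, Finset.sum_eq_zero]
        · simp
        · intro u _
          refine if_neg fun h => ?_
          have := congrFun h x
          simp only [hcount, if_true, h0] at this
          omega
      · let k' : α → ℕ := Function.update k x (k x - 1)
        have hk' : ∑ y, k' y = n := by
          have h1 := Finset.add_sum_erase Finset.univ k (Finset.mem_univ x)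
          have h2 := Finset.add_sum_erase Finset.univ k' (Finset.mem_univ x)
          have h3 : ∑ y ∈ Finset.univ.erase x, k' y = ∑ y ∈ Finset.univ.erase x, k y :=
            Finset.sum_congr rfl fun y hy => by
              simp [k', Function.update_of_ne (Finset.ne_of_mem_erase hy)]
          have h4 : k' x = k x - 1 := by simp [k']
          omega
        have hfac : ∏ y, ((k y).factorial : ℝ) = k x * ∏ y, ((k' y).factorial : ℝ) := by
          rw [← Finset.mul_prod_erase Finset.univ _ (Finset.mem_univ x),
            ← Finset.mul_prod_erase Finset.univ (fun y => ((k' y).factorial : ℝ))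
              (Finset.mem_univ x), ← mul_assoc]
          congr 1
          · have h4 : k' x = k x - 1 := by simp [k']
            rw [h4, ← Nat.cast_mul, Nat.mul_factorial_pred hpos.ne']
          · refine Finset.prod_congr rfl fun y hy => ?_
            simp [k', Function.update_of_ne (Finset.ne_of_mem_erase hy)]
        rw [hfac, ← ih k' hk']
        have : ∀ u : Fin n → α,
            ((fun y => (List.ofFn (Fin.cons x u : Fin (n + 1) → α)).count y) = k) ↔
              ((fun y => (List.ofFn u).count y) = k') := by
          intro u
          simp only [funext_iff, hcount, k', Function.update_apply]
          refine forall_congr' fun y => ?_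
          by_cases hxy : x = y
          · subst hxy
            simp only [if_true]
            omega
          · simp [hxy, Ne.symm hxy]
        simp only [this]
        ring
    rw [Finset.sum_mul]
    simp only [hstep, ← Finset.sum_mul]
    rw [← Nat.cast_sum, hk, Nat.factorial_succ]
    push_cast
    ring

theorem prod_word_eq_prod_pow_count {α : Type*} [Fintype α] [DecidableEq α] (f : α → ℝ)
    (v : List α) : (v.map f).prod = ∏ x, f x ^ v.count x :=
  (Finset.prod_list_map_count v f).trans <|
    Finset.prod_subset (Finset.subset_univ _) fun x _ hx => by
      rw [List.count_eq_zero.2 fun h => hx (List.mem_toFinset.2 h), pow_zero]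

/-- The induction step amounts to `(k + 1) log (1 + 1 / k) ≥ 1`. Any error logarithmic in `k` is
harmless, so full Stirling is not needed here. -/
theorem log_factorial_le (k : ℕ) :
    Real.log (k.factorial : ℝ) ≤ k * Real.log k - k + 1 + Real.log (k + 1) := by
  rcases Nat.eq_zero_or_pos k with rfl | hk
  · simp
  suffices h : Real.log (k.factorial : ℝ) ≤ k * Real.log k - k + 1 + Real.log k by
    have hk0 : (0 : ℝ) < k := by exact_mod_cast hk
    have := Real.log_le_log hk0 (show (k : ℝ) ≤ k + 1 by linarith)
    linarith
  induction k, hk using Nat.le_induction with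
  | base => simp
  | succ k hk ih =>
    have hk0 : (0 : ℝ) < k := by exact_mod_cast hk
    rw [Nat.factorial_succ, Nat.cast_mul, Real.log_mul (by positivity) (by positivity)]
    push_cast
    have h2 := Real.log_le_sub_one_of_pos (show (0 : ℝ) < k / (k + 1) by positivity)
    rw [Real.log_div hk0.ne' (by positivity)] at h2
    have h3 := mul_le_mul_of_nonneg_left h2 (show (0 : ℝ) ≤ k + 1 by positivity)
    have h4 : ((k : ℝ) + 1) * (k / (k + 1) - 1) = -1 := by
      field_simp
      ring
    rw [h4] at h3
    linarith

theorem le_log_factorial (n : ℕ) : n * Real.log n - n ≤ Real.log (n.factorial : ℝ) := by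
  rcases eq_or_ne n 0 with rfl | hn
  · simp
  have h := Stirling.le_log_factorial_stirling hn
  have h1 : 0 ≤ Real.log (n : ℝ) := Real.log_natCast_nonneg n
  have h2 : 0 ≤ Real.log (2 * Real.pi) := Real.log_nonneg (by nlinarith [Real.pi_gt_three])
  linarith

open Classical in
/-- The probability of a type class is at least `exp (-relative entropy)`, up to a polynomial
factor. -/
theorem type_class_prob_ge {α : Type*} [Fintype α] {f : α → ℝ} (hf : ∀ x, 0 < f x) (n : ℕ)
    (k : α → ℕ) (hk : ∑ x, k x = n) :
    Real.exp (-relEntropy f (fun x => (k x : ℝ)) -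
        Fintype.card α * (1 + Real.log (n + 1))) ≤
      ∑ u : Fin n → α, (if (fun x => (List.ofFn u).count x) = k then ∏ i, f (u i) else 0) := by
  have hsum : ∑ u : Fin n → α,
      (if (fun x => (List.ofFn u).count x) = k then ∏ i, f (u i) else 0) =
      (∑ u : Fin n → α, (if (fun x => (List.ofFn u).count x) = k then (1 : ℝ) else 0)) *
        ∏ x, f x ^ k x := by
    rw [Finset.sum_mul]
    refine Finset.sum_congr rfl fun u _ => ?_
    split_ifs with h
    · have h1 := prod_word_eq_prod_pow_count f (List.ofFn u)
      rw [List.map_ofFn, List.prod_ofFn] at h1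
      simp only [Function.comp_apply] at h1
      rw [h1, one_mul, ← h]
    · simp
  have hfac : (0 : ℝ) < ∏ x, ((k x).factorial : ℝ) :=
    Finset.prod_pos fun x _ => by exact_mod_cast Nat.factorial_pos _
  rw [hsum, ← mul_div_cancel_right₀ (∑ u : Fin n → α,
    (if (fun x => (List.ofFn u).count x) = k then (1 : ℝ) else 0)) hfac.ne',
    card_words_with_counts_mul n k hk]
  have hpos : 0 < (n.factorial : ℝ) / (∏ x, ((k x).factorial : ℝ)) * ∏ x, f x ^ k x := by
    have : (0 : ℝ) < n.factorial := by exact_mod_cast Nat.factorial_pos _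
    have := Finset.prod_pos fun x (_ : x ∈ Finset.univ) => pow_pos (hf x) (k x)
    positivity
  rw [← Real.le_log_iff_exp_le hpos, Real.log_mul (by
    have : (n.factorial : ℝ) ≠ 0 := by exact_mod_cast Nat.factorial_ne_zero _
    exact div_ne_zero this hfac.ne') (Finset.prod_pos fun x _ => pow_pos (hf x) (k x)).ne',
    Real.log_div (by exact_mod_cast Nat.factorial_ne_zero _) hfac.ne',
    Real.log_prod fun x _ => by exact_mod_cast Nat.factorial_ne_zero _,
    Real.log_prod fun x _ => (pow_pos (hf x) (k x)).ne']
  simp only [Real.log_pow]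
  -- The linear term `-n` cancels against the one from `n!`, and the error stays logarithmic in `n`.
  have h1 : ∑ x, Real.log ((k x).factorial : ℝ) ≤
      ∑ x, ((k x : ℝ) * Real.log (k x)) - n + Fintype.card α * (1 + Real.log (n + 1)) := by
    calc ∑ x, Real.log ((k x).factorial : ℝ)
        ≤ ∑ x, ((k x : ℝ) * Real.log (k x) - k x + (1 + Real.log (n + 1))) := by
          refine Finset.sum_le_sum fun x _ => (log_factorial_le (k x)).trans ?_
          have hkn : k x ≤ n := hk ▸ Finset.single_le_sum (fun i _ => Nat.zero_le (k i))
            (Finset.mem_univ x)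
          have : Real.log ((k x : ℝ) + 1) ≤ Real.log (n + 1) :=
            Real.log_le_log (by positivity) (by
              have : (k x : ℝ) ≤ n := by exact_mod_cast hkn
              linarith)
          linarith
      _ = _ := by
          rw [Finset.sum_add_distrib, Finset.sum_sub_distrib, ← Nat.cast_sum, hk,
            Finset.sum_const, Finset.card_univ, nsmul_eq_mul]
  have h2 := le_log_factorial n
  simp only [relEntropy]
  rw [← Nat.cast_sum, hk]
  linarith

theorem sum_map_eq_sum_count {E : Type*} [Fintype E] [DecidableEq E] (h : E → ℝ) (v : List E) :
    (v.map h).sum = ∑ e, (v.count e : ℝ) * h e := by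
  rw [Finset.sum_list_map_count]
  simp only [nsmul_eq_mul]
  exact Finset.sum_subset (Finset.subset_univ _) fun x _ hx => by
    rw [List.count_eq_zero.2 fun h => hx (List.mem_toFinset.2 h)]
    simp

/-- The event is tested through letter sums because the acceptance and pruning rules see a word only
through its sums of `logA`, `logB`, `logAB`. -/
theorem prob_ge_of_forall_type {α : Type*} [Fintype α] {f : α → ℝ} (hf : ∀ x, 0 < f x) {n : ℕ}
    {k : α → ℕ} (hk : ∑ x, k x = n) (Q : (Fin n → α) → Prop) {_ : DecidablePred Q}
    (hQ : ∀ u, (∀ h : α → ℝ, ((List.ofFn u).map h).sum = ∑ x, (k x : ℝ) * h x) → Q u) :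
    Real.exp (-relEntropy f (fun x => (k x : ℝ)) -
        Fintype.card α * (1 + Real.log (n + 1))) ≤
      ∑ u : Fin n → α, (if Q u then ∏ i, f (u i) else 0) := by
  classical
  refine (type_class_prob_ge hf n k hk).trans (Finset.sum_le_sum fun u _ => ?_)
  split_ifs with ha hb hb
  · exact le_rfl
  · exact absurd (hQ u fun h => by rw [sum_map_eq_sum_count, ← ha]) hb
  · exact Finset.prod_nonneg fun i _ => (hf _).le
  · exact le_rfl

/-! ### Rounding a finite measure down to integers -/

/-- Each `x log x` grows by at most 1 under rounding down, the term in `log p` only improves since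
`p ≤ 1`, and the total mass drops by at most `card E`. The loss is thus logarithmic in the total
mass. -/
theorem relEntropy_floor_le {E : Type*} [Fintype E] {p x : E → ℝ} (hp0 : ∀ e, 0 < p e)
    (hp1 : ∀ e, p e ≤ 1) (hx : ∀ e, 0 ≤ x e) :
    relEntropy p (fun e => (⌊x e⌋₊ : ℝ)) ≤
      relEntropy p x + Fintype.card E * (2 + Real.log (∑ e, x e + 1)) := by
  have hfl : ∀ e, (⌊x e⌋₊ : ℝ) ≤ x e := fun e => Nat.floor_le (hx e)
  have h1 : ∑ e, (⌊x e⌋₊ : ℝ) * Real.log (⌊x e⌋₊ : ℝ) ≤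
      ∑ e, x e * Real.log (x e) + Fintype.card E := by
    have : ∀ e, (⌊x e⌋₊ : ℝ) * Real.log (⌊x e⌋₊ : ℝ) ≤ x e * Real.log (x e) + 1 := by
      intro e
      rcases Nat.eq_zero_or_pos ⌊x e⌋₊ with h | h
      · rw [h]
        have := mul_log_ge_affine (hx e) le_rfl one_pos
        rcases (hx e).eq_or_lt with h0 | h0
        · rw [← h0]; simp
        · have h3 := Real.one_sub_inv_le_log_of_pos h0
          have h4 := mul_le_mul_of_nonneg_left h3 h0.le
          have h5 : x e * (1 - (x e)⁻¹) = x e - 1 := by field_simp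
          simp
          linarith
      · have h1' : (1 : ℝ) ≤ ⌊x e⌋₊ := by exact_mod_cast h
        have h2 := Real.log_nonneg h1'
        have h3 := Real.log_le_log (by linarith) (hfl e)
        have := mul_le_mul (hfl e) h3 h2 (hx e)
        linarith
    calc _ ≤ ∑ e, (x e * Real.log (x e) + 1) := Finset.sum_le_sum fun e _ => this e
      _ = _ := by simp [Finset.sum_add_distrib]
  have h2 : -∑ e, (⌊x e⌋₊ : ℝ) * Real.log (p e) ≤ -∑ e, x e * Real.log (p e) := by
    rw [neg_le_neg_iff]
    exact Finset.sum_le_sum fun e _ =>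
      mul_le_mul_of_nonpos_right (hfl e) (Real.log_nonpos (hp0 e).le (hp1 e))
  set T : ℝ := ∑ e, x e with hT
  set n : ℝ := ∑ e, (⌊x e⌋₊ : ℝ) with hn
  have hn0 : 0 ≤ n := Finset.sum_nonneg fun e _ => Nat.cast_nonneg _
  have hnT : n ≤ T := Finset.sum_le_sum fun e _ => hfl e
  have hTn : T - n ≤ Fintype.card E := by
    rw [hT, hn, ← Finset.sum_sub_distrib]
    calc ∑ e, (x e - ⌊x e⌋₊) ≤ ∑ _e : E, (1 : ℝ) :=
          Finset.sum_le_sum fun e _ => by linarith [Nat.lt_floor_add_one (x e)]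
      _ = _ := by simp
  -- The tangent of `y log y` at `T` bounds the difference by `(T - n) (1 + log T)`.
  have h3 : T * Real.log T - n * Real.log n ≤
      Fintype.card E * (1 + Real.log (T + 1)) := by
    rcases (hn0.trans hnT).eq_or_lt with h0 | h0
    · have : n = 0 := by linarith
      rw [this, ← h0]
      simp
    · have hl : 0 ≤ Real.log (T + 1) := Real.log_nonneg (by linarith)
      have hl2 : Real.log T ≤ Real.log (T + 1) := Real.log_le_log h0 (by linarith)
      have h4 := mul_log_ge_affine hn0 le_rfl h0
      have h5 : n * Real.log n - n * Real.log n = 0 := sub_self _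
      have h6 : n * Real.log T + n - T ≤ n * Real.log n := by
        rcases hn0.eq_or_lt with hz | hz
        · rw [← hz]; simp; exact h0.le
        · have := Real.log_le_sub_one_of_pos (show 0 < T / n by positivity)
          rw [Real.log_div h0.ne' hz.ne'] at this
          have h7 := mul_le_mul_of_nonneg_left this hz.le
          have h8 : n * (T / n - 1) = T - n := by field_simp
          linarith
      calc T * Real.log T - n * Real.log n ≤ (T - n) * (1 + Real.log T) := by linarith
        _ ≤ (T - n) * (1 + Real.log (T + 1)) :=
            mul_le_mul_of_nonneg_left (by linarith) (by linarith)
        _ ≤ _ := mul_le_mul_of_nonneg_right hTn (by linarith)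
  simp only [relEntropy]
  linarith

/-! ### Elementary facts on the one-letter distribution -/

theorem margA_pos {A B : Type*} [Fintype B] [Nonempty B] {p : A → B → ℝ}
    (hpos : ∀ i j, 0 < p i j) (i : A) : 0 < margA p i :=
  Finset.sum_pos (fun j _ => hpos i j) Finset.univ_nonempty

theorem margB_pos {A B : Type*} [Fintype A] [Nonempty A] {p : A → B → ℝ}
    (hpos : ∀ i j, 0 < p i j) (j : B) : 0 < margB p j :=
  Finset.sum_pos (fun i _ => hpos i j) Finset.univ_nonempty

theorem lt_margA {A B : Type*} [Fintype B] [Nontrivial B] {p : A → B → ℝ}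
    (hpos : ∀ i j, 0 < p i j) (i : A) (j : B) : p i j < margA p i := by
  obtain ⟨j', hj'⟩ := exists_ne j
  exact Finset.single_lt_sum hj' (Finset.mem_univ j) (Finset.mem_univ j') (hpos i j')
    fun k _ _ => (hpos i k).le

theorem lt_margB {A B : Type*} [Fintype A] [Nontrivial A] {p : A → B → ℝ}
    (hpos : ∀ i j, 0 < p i j) (i : A) (j : B) : p i j < margB p j := by
  obtain ⟨i', hi'⟩ := exists_ne i
  exact Finset.single_lt_sum hi' (Finset.mem_univ i) (Finset.mem_univ i') (hpos i' j)
    fun k _ _ => (hpos k j).le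

variable {A B : Type*} [Fintype A] [Fintype B]

theorem sum_margA (p : A → B → ℝ) : ∑ i, margA p i = ∑ i, ∑ j, p i j := rfl

theorem sum_margB (p : A → B → ℝ) : ∑ j, margB p j = ∑ i, ∑ j, p i j := Finset.sum_comm

theorem margA_le_one [Nonempty B] {p : A → B → ℝ} (hpos : ∀ i j, 0 < p i j)
    (hsum : ∑ i, ∑ j, p i j = 1) (i : A) : margA p i ≤ 1 :=
  (Finset.single_le_sum (fun i _ => (margA_pos hpos i).le) (Finset.mem_univ i)).trans_eq hsum

theorem margB_le_one [Nonempty A] {p : A → B → ℝ} (hpos : ∀ i j, 0 < p i j)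
    (hsum : ∑ i, ∑ j, p i j = 1) (j : B) : margB p j ≤ 1 :=
  (Finset.single_le_sum (fun j _ => (margB_pos hpos j).le) (Finset.mem_univ j)).trans_eq
    ((sum_margB p).trans hsum)

theorem lt_one_of_pos [Nontrivial A] [Nontrivial B] {p : A → B → ℝ} (hpos : ∀ i j, 0 < p i j)
    (hsum : ∑ i, ∑ j, p i j = 1) (i : A) (j : B) : p i j < 1 :=
  (lt_margA hpos i j).trans_le (margA_le_one hpos hsum i)

theorem sum_prod_type_eq_one {p : A → B → ℝ} (hsum : ∑ i, ∑ j, p i j = 1) :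
    ∑ e : A × B, p e.1 e.2 = 1 := by
  rw [Fintype.sum_prod_type]
  exact hsum

theorem sum_margA_mul_margB {p : A → B → ℝ} (hsum : ∑ i, ∑ j, p i j = 1) :
    ∑ e : A × B, margA p e.1 * margB p e.2 = 1 := by
  rw [Fintype.sum_prod_type]
  simp only [← Finset.mul_sum, sum_margB, hsum, mul_one, sum_margA]

theorem pZero_pos {p : A → B → ℝ} (hpos : ∀ i j, 0 < p i j) : 0 < pZero p :=
  Finset.prod_pos fun i _ => Finset.prod_pos fun j _ => hpos i j

theorem pZero_le [Nontrivial A] [Nontrivial B] {p : A → B → ℝ} (hpos : ∀ i j, 0 < p i j)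
    (hsum : ∑ i, ∑ j, p i j = 1) (i : A) (j : B) : pZero p ≤ p i j := by
  classical
  have h : pZero p = ∏ e : A × B, p e.1 e.2 :=
    (Fintype.prod_prod_type fun e : A × B => p e.1 e.2).symm
  rw [h, ← Finset.mul_prod_erase _ _ (Finset.mem_univ (i, j))]
  refine mul_le_of_le_one_right (hpos i j).le (Finset.prod_le_one (fun e _ => (hpos _ _).le)
    fun e _ => (lt_one_of_pos hpos hsum _ _).le)

theorem qZero_pos [Nonempty A] [Nonempty B] {p : A → B → ℝ} (hpos : ∀ i j, 0 < p i j) :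
    0 < qZero p := by
  refine lt_min ?_ (lt_min ?_ ?_)
  · exact Finset.prod_pos fun i _ => Finset.prod_pos fun j _ =>
      mul_pos (margA_pos hpos i) (margB_pos hpos j)
  · exact Finset.prod_pos fun i _ => pow_pos (margA_pos hpos i) _
  · exact Finset.prod_pos fun i _ => pow_pos (margB_pos hpos i) _

theorem qZero_le_prod (p : A → B → ℝ) :
    qZero p ≤ ∏ e : A × B, margA p e.1 * margB p e.2 := by
  rw [Fintype.prod_prod_type]
  exact min_le_left _ _

theorem qZero_le_one [Nonempty A] [Nonempty B] {p : A → B → ℝ} (hpos : ∀ i j, 0 < p i j)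
    (hsum : ∑ i, ∑ j, p i j = 1) : qZero p ≤ 1 :=
  (qZero_le_prod p).trans <| Finset.prod_le_one
    (fun _ _ => (mul_pos (margA_pos hpos _) (margB_pos hpos _)).le) fun _ _ =>
      mul_le_one₀ (margA_le_one hpos hsum _) (margB_pos hpos _).le (margB_le_one hpos hsum _)

theorem pZero_mul_qZero_pos [Nonempty A] [Nonempty B] {p : A → B → ℝ}
    (hpos : ∀ i j, 0 < p i j) : 0 < pZero p * qZero p :=
  mul_pos (pZero_pos hpos) (qZero_pos hpos)

theorem pZero_mul_qZero_lt_one [Nontrivial A] [Nontrivial B] {p : A → B → ℝ}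
    (hpos : ∀ i j, 0 < p i j) (hsum : ∑ i, ∑ j, p i j = 1) : pZero p * qZero p < 1 := by
  obtain ⟨i⟩ := (inferInstance : Nonempty A)
  obtain ⟨j⟩ := (inferInstance : Nonempty B)
  calc pZero p * qZero p ≤ pZero p * 1 :=
        mul_le_mul_of_nonneg_left (qZero_le_one hpos hsum) (pZero_pos hpos).le
    _ = pZero p := mul_one _
    _ ≤ p i j := pZero_le hpos hsum i j
    _ < 1 := lt_one_of_pos hpos hsum i j

/-! ### Logarithmic likelihood ratios -/

/-- `log (p_ij / p_i^A)`. -/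
def logA (p : A → B → ℝ) (e : A × B) : ℝ := Real.log (p e.1 e.2 / margA p e.1)

/-- `log (p_ij / p_j^B)`. -/
def logB (p : A → B → ℝ) (e : A × B) : ℝ := Real.log (p e.1 e.2 / margB p e.2)

/-- `log (p_ij / q_ij)`. -/
def logAB (p : A → B → ℝ) (e : A × B) : ℝ :=
  Real.log (p e.1 e.2 / (margA p e.1 * margB p e.2))

theorem logA_neg {A B : Type*} [Fintype B] [Nontrivial B] {p : A → B → ℝ}
    (hpos : ∀ i j, 0 < p i j) (e : A × B) : logA p e < 0 :=
  Real.log_neg (div_pos (hpos _ _) (margA_pos hpos _))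
    ((div_lt_one (margA_pos hpos _)).2 (lt_margA hpos _ _))

theorem logB_neg {A B : Type*} [Fintype A] [Nontrivial A] {p : A → B → ℝ}
    (hpos : ∀ i j, 0 < p i j) (e : A × B) : logB p e < 0 :=
  Real.log_neg (div_pos (hpos _ _) (margB_pos hpos _))
    ((div_lt_one (margB_pos hpos _)).2 (lt_margB hpos _ _))

theorem logAB_eq [Nonempty A] [Nonempty B] {p : A → B → ℝ} (hpos : ∀ i j, 0 < p i j)
    (e : A × B) : logAB p e = logA p e + logB p e - Real.log (p e.1 e.2) := by
  have h1 := (margA_pos hpos e.1).ne'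
  have h2 := (margB_pos hpos e.2).ne'
  have h3 := (hpos e.1 e.2).ne'
  rw [logAB, logA, logB, Real.log_div h3 (mul_ne_zero h1 h2), Real.log_mul h1 h2,
    Real.log_div h3 h1, Real.log_div h3 h2]
  ring

/-- The exponential sum which the multiplier set normalises to one. -/
def tiltSum (p : A → B → ℝ) (μ ν η : ℝ) : ℝ :=
  ∑ e : A × B, p e.1 e.2 *
    Real.exp (μ * logA p e + ν * logB p e - η * Real.log (p e.1 e.2))

theorem tiltSum_eq [Nonempty A] [Nonempty B] {p : A → B → ℝ} (hpos : ∀ i j, 0 < p i j)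
    (μ ν η : ℝ) :
    ∑ i, ∑ j, (p i j) ^ (1 + μ + ν - η) * (margA p i) ^ (-μ) * (margB p j) ^ (-ν) =
      tiltSum p μ ν η := by
  rw [tiltSum, Fintype.sum_prod_type]
  refine Finset.sum_congr rfl fun i _ => Finset.sum_congr rfl fun j _ => ?_
  have h1 := margA_pos hpos i
  have h2 := margB_pos hpos j
  have h3 := hpos i j
  rw [Real.rpow_def_of_pos h1, Real.rpow_def_of_pos h2, Real.rpow_def_of_pos h3]
  conv_rhs => rw [← Real.exp_log h3]
  rw [← Real.exp_add, ← Real.exp_add, ← Real.exp_add]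
  congr 1
  simp only [logA, logB]
  rw [Real.log_div h3.ne' h1.ne', Real.log_div h3.ne' h2.ne', Real.exp_log h3]
  ring

/-! ### The multiplier set, `λ*` and the optimal type -/

theorem mem_multiplierSet_iff [Nonempty A] [Nonempty B] {p : A → B → ℝ}
    (hpos : ∀ i j, 0 < p i j) {μ ν η : ℝ} :
    (μ, ν, η) ∈ multiplierSet p ↔ η ≤ min μ ν ∧ 0 ≤ η ∧ tiltSum p μ ν η = 1 := by
  rw [← tiltSum_eq hpos]
  rfl

/-- On the diagonal the exponent is `ν logAB`. By `exp x ≥ 1 + x` the sum is at least 1 plus `ν`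
times the mutual information of `P`, which is nonnegative. -/
theorem one_le_tiltSum_diag [Nonempty A] [Nonempty B] {p : A → B → ℝ} (hpos : ∀ i j, 0 < p i j)
    (hsum : ∑ i, ∑ j, p i j = 1) {ν : ℝ} (hν : 0 ≤ ν) : 1 ≤ tiltSum p ν ν ν := by
  have hZ : 0 ≤ ∑ e : A × B, p e.1 e.2 * logAB p e := by
    have h : ∀ e : A × B, p e.1 e.2 - margA p e.1 * margB p e.2 ≤ p e.1 e.2 * logAB p e := by
      intro e
      have h3 := hpos e.1 e.2
      have hq := mul_pos (margA_pos hpos e.1) (margB_pos hpos e.2)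
      have := mul_le_mul_of_nonneg_left (Real.one_sub_inv_le_log_of_pos (div_pos h3 hq)) h3.le
      refine le_trans (le_of_eq ?_) this
      field_simp
    have := Finset.sum_le_sum fun e (_ : e ∈ (Finset.univ : Finset (A × B))) => h e
    rw [Finset.sum_sub_distrib, sum_prod_type_eq_one hsum, sum_margA_mul_margB hsum] at this
    linarith
  calc (1 : ℝ) ≤ ∑ e : A × B, p e.1 e.2 + ν * ∑ e : A × B, p e.1 e.2 * logAB p e := by
        rw [sum_prod_type_eq_one hsum]
        linarith [mul_nonneg hν hZ]
    _ = ∑ e : A × B, p e.1 e.2 * (ν * logAB p e + 1) := by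
        rw [Finset.mul_sum, ← Finset.sum_add_distrib]
        exact Finset.sum_congr rfl fun e _ => by ring
    _ ≤ tiltSum p ν ν ν := by
        refine Finset.sum_le_sum fun e _ => mul_le_mul_of_nonneg_left ?_ (hpos _ _).le
        rw [show ν * logA p e + ν * logB p e - ν * Real.log (p e.1 e.2) = ν * logAB p e by
          rw [logAB_eq hpos]; ring]
        exact Real.add_one_le_exp _

/-- Makes the supremum genuine: the real `sSup` of an unbounded set would be 0. -/
theorem bddAbove_lamStar [Nonempty A] [Nonempty B] (p : A → B → ℝ) {δ : ℝ} (hδ : 0 ≤ δ) :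
    ∀ t ∈ multiplierSet p,
      (max 1 δ + t.1 + t.2.1 * δ) / (1 + t.1 + t.2.1 - t.2.2) ≤ 1 + δ := by
  rintro ⟨μ, ν, η⟩ ⟨h1, h2, -⟩
  simp only at h1 h2 ⊢
  have hμ := h1.trans (min_le_left _ _)
  have hν := h1.trans (min_le_right _ _)
  rw [div_le_iff₀ (by linarith)]
  have hm : max 1 δ ≤ 1 + δ := max_le (by linarith) (by linarith)
  nlinarith [mul_nonneg hδ (sub_nonneg.2 hμ)]

theorem le_lamStar_of_mem [Nonempty A] [Nonempty B] (p : A → B → ℝ) {δ : ℝ} (hδ : 0 ≤ δ)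
    {μ ν η : ℝ} (h : (μ, ν, η) ∈ multiplierSet p) :
    max 1 δ + μ + ν * δ ≤ lamStar p δ * (1 + μ + ν - η) := by
  have h1 := h.1.trans (min_le_left _ _)
  have h2 := h.1.trans (min_le_right _ _)
  have h3 := h.2.1
  simp only at h1 h2 h3
  rw [← div_le_iff₀ (by linarith)]
  refine le_csSup ⟨1 + δ, ?_⟩ ⟨(μ, ν, η), h, rfl⟩
  rintro _ ⟨t, ht, rfl⟩
  exact bddAbove_lamStar p hδ t ht

theorem zero_mem_multiplierSet [Nonempty A] [Nonempty B] {p : A → B → ℝ}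
    (hsum : ∑ i, ∑ j, p i j = 1) : ((0 : ℝ), (0 : ℝ), (0 : ℝ)) ∈ multiplierSet p := by
  refine ⟨by simp, le_rfl, ?_⟩
  simpa using hsum

theorem max_le_lamStar [Nonempty A] [Nonempty B] {p : A → B → ℝ}
    (hsum : ∑ i, ∑ j, p i j = 1) {δ : ℝ} (hδ : 0 ≤ δ) : max 1 δ ≤ lamStar p δ := by
  simpa using le_lamStar_of_mem p hδ (zero_mem_multiplierSet hsum)

theorem continuous_tiltSum (p : A → B → ℝ) :
    Continuous fun t : ℝ × ℝ × ℝ => tiltSum p t.1 t.2.1 t.2.2 := by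
  unfold tiltSum
  fun_prop

/-- Triples whose exponential sum is at most one do not beat `λ*` either. -/
theorem le_lamStar_of_tiltSum_le_one [Nonempty A] [Nonempty B] {p : A → B → ℝ}
    (hpos : ∀ i j, 0 < p i j) (hsum : ∑ i, ∑ j, p i j = 1) {δ : ℝ} (hδ : 0 ≤ δ) {μ ν η : ℝ}
    (hη : 0 ≤ η) (hμ : η ≤ μ) (hν : η ≤ ν) (hF : tiltSum p μ ν η ≤ 1) :
    max 1 δ + μ + ν * δ ≤ lamStar p δ * (1 + μ + ν - η) := by
  have hlam := max_le_lamStar hsum hδ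
  have hlam1 := (le_max_left 1 δ).trans hlam
  have hlamδ := (le_max_right 1 δ).trans hlam
  have hm : η ≤ min μ ν := le_min hμ hν
  -- If raising `η` up to `min μ ν` reaches the value 1, membership holds at some larger `x`, and
  -- the bound there is the stronger one since `λ* ≥ 0`.
  rcases le_or_gt 1 (tiltSum p μ ν (min μ ν)) with h1 | h1
  · have hc : ContinuousOn (fun x => tiltSum p μ ν x) (Set.Icc η (min μ ν)) :=
      ((continuous_tiltSum p).comp
        (continuous_const.prodMk (continuous_const.prodMk continuous_id))).continuousOn
    obtain ⟨x, ⟨hx1, hx2⟩, hx⟩ := intermediate_value_Icc hm hc ⟨hF, h1⟩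
    have := le_lamStar_of_mem p hδ ((mem_multiplierSet_iff hpos).2 ⟨hx2, hη.trans hx1, hx⟩)
    nlinarith
  -- Otherwise the sum is still below 1 at `η = min μ ν`, while it is at least 1 on the diagonal, so
  -- lowering the larger of `μ`, `ν` meets 1. Going back up costs 1 per unit of `μ` or `δ` per unit
  -- of `ν`, and `λ*` dominates both.
  · rcases le_total ν μ with hle | hle
    · rw [min_eq_right hle] at h1
      have hc : ContinuousOn (fun x => tiltSum p x ν ν) (Set.Icc ν μ) :=
        ((continuous_tiltSum p).comp
          (continuous_id.prodMk (continuous_const.prodMk continuous_const))).continuousOn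
      obtain ⟨x, ⟨hx1, hx2⟩, hx⟩ := intermediate_value_Icc' hle hc
        ⟨h1.le, one_le_tiltSum_diag hpos hsum (hη.trans hν)⟩
      have := le_lamStar_of_mem p hδ ((mem_multiplierSet_iff hpos).2
        ⟨le_min hx1 le_rfl, hη.trans hν, hx⟩)
      nlinarith
    · rw [min_eq_left hle] at h1
      have hc : ContinuousOn (fun x => tiltSum p μ x μ) (Set.Icc μ ν) :=
        ((continuous_tiltSum p).comp
          (continuous_const.prodMk (continuous_id.prodMk continuous_const))).continuousOn
      obtain ⟨x, ⟨hx1, hx2⟩, hx⟩ := intermediate_value_Icc' hle hc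
        ⟨h1.le, one_le_tiltSum_diag hpos hsum (hη.trans hμ)⟩
      have := le_lamStar_of_mem p hδ ((mem_multiplierSet_iff hpos).2
        ⟨le_min le_rfl hx1, hη.trans hμ, hx⟩)
      nlinarith

/-- A type whose likelihood ratios meet the thresholds of the tree and whose relative entropy is at
most `λ* - max 1 δ`. -/
theorem exists_optimal_type [Nontrivial A] [Nontrivial B] {p : A → B → ℝ}
    (hpos : ∀ i j, 0 < p i j) (hsum : ∑ i, ∑ j, p i j = 1) {δ : ℝ} (hδ : 0 ≤ δ) :
    ∃ s : A × B → ℝ, (∀ e, 0 ≤ s e) ∧ 1 + δ - lamStar p δ ≤ ∑ e, s e * logAB p e ∧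
      -(lamStar p δ - 1) ≤ ∑ e, s e * logA p e ∧ -(lamStar p δ - δ) ≤ ∑ e, s e * logB p e ∧
      relEntropy (fun e : A × B => p e.1 e.2) s ≤ lamStar p δ - max 1 δ := by
  refine exists_relEntropy_le_of_dual (fun e => hpos e.1 e.2) (sum_prod_type_eq_one hsum)
    (logA_neg hpos) ?_
  intro η μ ν hη hμ hν h
  -- Since `logAB = logA + logB - log p`, a multiplier `η` on `logAB` adds `η` to both `μ` and `ν`;
  -- this is the source of the constraint `min μ ν ≥ η`.
  have := le_lamStar_of_tiltSum_le_one hpos hsum hδ (μ := μ + η) (ν := ν + η) hη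
    (by linarith) (by linarith) (by
      refine le_trans (le_of_eq ?_) h
      refine Finset.sum_congr rfl fun e _ => ?_
      congr 2
      rw [logAB_eq hpos]
      ring)
  linarith

/-! ### Node weights -/

theorem Phi_append_singleton {A B : Type*} (p : A → B → ℝ) (u : List (A × B)) (e : A × B) :
    Phi p (u ++ [e]) = Phi p u * p e.1 e.2 := by
  simp [Phi]

theorem Phi_pos {A B : Type*} {p : A → B → ℝ} (hpos : ∀ i j, 0 < p i j) (v : List (A × B)) :
    0 < Phi p v :=
  List.prod_pos fun x hx => by
    obtain ⟨e, -, rfl⟩ := List.mem_map.1 hx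
    exact hpos _ _

theorem PsiA_pos {A B : Type*} [Fintype B] [Nonempty B] {p : A → B → ℝ}
    (hpos : ∀ i j, 0 < p i j) (v : List (A × B)) :
    0 < PsiA p v :=
  List.prod_pos fun x hx => by
    obtain ⟨e, -, rfl⟩ := List.mem_map.1 hx
    exact margA_pos hpos _

theorem PsiB_pos {A B : Type*} [Fintype A] [Nonempty A] {p : A → B → ℝ}
    (hpos : ∀ i j, 0 < p i j) (v : List (A × B)) :
    0 < PsiB p v :=
  List.prod_pos fun x hx => by
    obtain ⟨e, -, rfl⟩ := List.mem_map.1 hx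
    exact margB_pos hpos _

theorem prod_map_div_prod_map_eq_exp {E : Type*} {f g : E → ℝ} (hf : ∀ e, 0 < f e)
    (hg : ∀ e, 0 < g e) (v : List E) :
    (v.map f).prod / (v.map g).prod = Real.exp ((v.map fun e => Real.log (f e / g e)).sum) := by
  induction v with
  | nil => simp
  | cons e v ih =>
    simp only [List.map_cons, List.prod_cons, List.sum_cons, Real.exp_add]
    rw [Real.exp_log (div_pos (hf e) (hg e)), ← ih, mul_div_mul_comm]

theorem Phi_div_PsiA {A B : Type*} [Fintype B] [Nonempty B] {p : A → B → ℝ}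
    (hpos : ∀ i j, 0 < p i j)
    (v : List (A × B)) : Phi p v / PsiA p v = Real.exp ((v.map (logA p)).sum) :=
  prod_map_div_prod_map_eq_exp (f := fun e : A × B => p e.1 e.2)
    (g := fun e : A × B => margA p e.1) (fun e => hpos e.1 e.2) (fun e => margA_pos hpos e.1) v

theorem Phi_div_PsiB {A B : Type*} [Fintype A] [Nonempty A] {p : A → B → ℝ}
    (hpos : ∀ i j, 0 < p i j)
    (v : List (A × B)) : Phi p v / PsiB p v = Real.exp ((v.map (logB p)).sum) :=
  prod_map_div_prod_map_eq_exp (f := fun e : A × B => p e.1 e.2)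
    (g := fun e : A × B => margB p e.2) (fun e => hpos e.1 e.2) (fun e => margB_pos hpos e.2) v

theorem Psi_eq_prod (p : A → B → ℝ) (v : List (A × B)) :
    Psi p v = (v.map fun e => margA p e.1 * margB p e.2).prod := by
  rw [List.prod_map_mul]
  rfl

theorem Phi_div_Psi [Nonempty A] [Nonempty B] {p : A → B → ℝ} (hpos : ∀ i j, 0 < p i j)
    (v : List (A × B)) : Phi p v / Psi p v = Real.exp ((v.map (logAB p)).sum) := by
  rw [Psi_eq_prod]
  exact prod_map_div_prod_map_eq_exp (fun e => hpos e.1 e.2)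
    (fun e => mul_pos (margA_pos hpos e.1) (margB_pos hpos e.2)) v

/-! ### Combinatorics of the tree -/

/-- Both ratios decrease along a path, since each `p_ij` is below its row and column marginals.
Hence the pruning condition passes to all extensions. -/
theorem not_prunes_of_append [Nontrivial A] [Nontrivial B] {p : A → B → ℝ}
    (hpos : ∀ i j, 0 < p i j) {δ : ℝ} {N : ℕ} {u : List (A × B)} {e : A × B}
    (h : ¬ Prunes p δ N (u ++ [e])) : ¬ Prunes p δ N u := by
  have hA : Phi p (u ++ [e]) / PsiA p (u ++ [e]) ≤ Phi p u / PsiA p u := by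
    rw [Phi_div_PsiA hpos, Phi_div_PsiA hpos, Real.exp_le_exp]
    simpa using (logA_neg hpos e).le
  have hB : Phi p (u ++ [e]) / PsiB p (u ++ [e]) ≤ Phi p u / PsiB p u := by
    rw [Phi_div_PsiB hpos, Phi_div_PsiB hpos, Real.exp_le_exp]
    simpa using (logB_neg hpos e).le
  rintro (h1 | h1)
  · exact h (Or.inl (hA.trans h1))
  · exact h (Or.inr (hB.trans h1))

theorem Branches.not_accepts {p : A → B → ℝ} {δ : ℝ} {N : ℕ} {u : List (A × B)}
    (h : Branches p δ N u) (hu : u ≠ []) : ¬ Accepts p δ N u := by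
  cases h with
  | root => exact absurd rfl hu
  | step v e _ hacc _ => exact hacc

theorem Branches.of_prefix {p : A → B → ℝ} {δ : ℝ} {N : ℕ} {u v : List (A × B)}
    (h : Branches p δ N u) (hv : v <+: u) : Branches p δ N v := by
  induction h with
  | root =>
    rw [List.prefix_nil.1 hv]
    exact Branches.root
  | step w e hw hacc hpru ih =>
    rcases List.prefix_concat_iff.1 hv with rfl | h
    · exact Branches.step w e hw hacc hpru
    · exact ih h

/-- No prefix of `v` satisfies the pruning condition, so the descent along `v` can only stop in a
bucket, possibly before `v` because `Φ / Ψ` is not monotone. The root is branched unconditionally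
and never is a bucket, hence `v ≠ []`. -/
theorem exists_bucket_prefix [Nontrivial A] [Nontrivial B] {p : A → B → ℝ}
    (hpos : ∀ i j, 0 < p i j) {δ : ℝ} {N : ℕ} {v : List (A × B)} (hv : v ≠ [])
    (hacc : Accepts p δ N v) (hpru : ¬ Prunes p δ N v) :
    ∃ w ∈ treeBuckets p δ N, w <+: v := by
  have key : ∀ v : List (A × B), ¬ Prunes p δ N v →
      Branches p δ N v ∨ ∃ w ∈ treeBuckets p δ N, w <+: v := by
    intro v
    induction v using List.reverseRecOn with
    | nil => exact fun _ => Or.inl Branches.root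
    | append_singleton u e ih =>
      intro hpru
      rcases ih (not_prunes_of_append hpos hpru) with hu | ⟨w, hw, hwu⟩
      · by_cases hacc : Accepts p δ N (u ++ [e])
        · exact Or.inr ⟨u ++ [e], ⟨u, e, hu, rfl, hacc⟩, List.prefix_rfl⟩
        · exact Or.inl (Branches.step u e hu hacc hpru)
      · exact Or.inr ⟨w, hw, hwu.trans (List.prefix_append u [e])⟩
  rcases key v hpru with h | h
  · exact absurd hacc (h.not_accepts hv)
  · exact h

theorem bucket_mem_treeNodes {p : A → B → ℝ} {δ : ℝ} {N : ℕ} {v : List (A × B)}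
    (h : v ∈ treeBuckets p δ N) : v ∈ treeNodes p δ N := by
  obtain ⟨u, e, hu, rfl, -⟩ := h
  exact Or.inr ⟨u, e, hu, rfl⟩

theorem bucket_not_branches {p : A → B → ℝ} {δ : ℝ} {N : ℕ} {v : List (A × B)}
    (h : v ∈ treeBuckets p δ N) : ¬ Branches p δ N v := by
  obtain ⟨u, e, -, rfl, hacc⟩ := h
  exact fun hb => hb.not_accepts (by simp) hacc

/-- A proper prefix of a created node is a prefix of its parent, and branching nodes are closed
under prefixes. This makes the leaves, and so the buckets, prefix-free. -/
theorem eq_of_leaf_prefix {p : A → B → ℝ} {δ : ℝ} {N : ℕ} {v w : List (A × B)}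
    (hv : ¬ Branches p δ N v) (hw : w ∈ treeNodes p δ N) (h : v <+: w) : v = w := by
  rcases hw with rfl | ⟨u, e, hu, rfl⟩
  · exact List.prefix_nil.1 h
  · rcases List.prefix_concat_iff.1 h with h | h
    · exact h
    · exact absurd (hu.of_prefix h) hv

/-! ### Bounds at the nodes -/

theorem rpow_one_le_of_nonpos {N : ℕ} (hN : 1 ≤ N) {x : ℝ} (hx : x ≤ 0) : (N : ℝ) ^ x ≤ 1 :=
  Real.rpow_le_one_of_one_le_of_nonpos (by exact_mod_cast hN) hx

/-- The construction does not test the root, but both its ratios are 1 while the thresholds are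
below 1, because `p₀ q₀ < 1` and `λ* ≥ max 1 δ`. -/
theorem Branches.not_prunes [Nontrivial A] [Nontrivial B] {p : A → B → ℝ}
    (hpos : ∀ i j, 0 < p i j) (hsum : ∑ i, ∑ j, p i j = 1) {δ : ℝ} (hδ : 0 ≤ δ) {N : ℕ}
    (hN : 1 ≤ N) {u : List (A × B)} (h : Branches p δ N u) : ¬ Prunes p δ N u := by
  cases h with
  | root =>
    have hlam := max_le_lamStar hsum hδ
    have hC := pZero_mul_qZero_lt_one hpos hsum
    have hC0 := (pZero_mul_qZero_pos hpos).le
    have hb : ∀ x : ℝ, x ≤ 0 → pZero p * qZero p * (N : ℝ) ^ x < 1 := fun x hx =>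
      (mul_le_of_le_one_right hC0 (rpow_one_le_of_nonpos hN hx)).trans_lt hC
    have h1 := hb (1 - lamStar p δ) (by linarith [(le_max_left 1 δ).trans hlam])
    have h2 := hb (δ - lamStar p δ) (by linarith [(le_max_right 1 δ).trans hlam])
    rintro (h | h)
    · simp [Phi, PsiA] at h
      linarith
    · simp [Phi, PsiB] at h
      linarith
  | step v e _ _ hpru => exact hpru

theorem Branches.lt_Phi_div [Nontrivial A] [Nontrivial B] {p : A → B → ℝ}
    (hpos : ∀ i j, 0 < p i j) (hsum : ∑ i, ∑ j, p i j = 1) {δ : ℝ} (hδ : 0 ≤ δ) {N : ℕ}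
    (hN : 1 ≤ N) {u : List (A × B)} (h : Branches p δ N u) :
    pZero p * qZero p * (N : ℝ) ^ (1 - lamStar p δ) < Phi p u / PsiA p u ∧
      pZero p * qZero p * (N : ℝ) ^ (δ - lamStar p δ) < Phi p u / PsiB p u := by
  have := h.not_prunes hpos hsum hδ hN
  rw [Prunes, not_or, not_le, not_le] at this
  exact this

/-- `Φ = (Φ/Ψ^A) (Φ/Ψ^B) / (Φ/Ψ)`: non-pruning bounds the numerator below, non-acceptance bounds the
denominator above, and the exponents combine to `-λ*`. The root is treated apart because it may
satisfy the acceptance inequality. -/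
theorem Branches.le_Phi [Nontrivial A] [Nontrivial B] {p : A → B → ℝ}
    (hpos : ∀ i j, 0 < p i j) (hsum : ∑ i, ∑ j, p i j = 1) {δ : ℝ} (hδ : 0 ≤ δ) {N : ℕ}
    (hN : 1 ≤ N) {u : List (A × B)} (h : Branches p δ N u) :
    pZero p * qZero p * (N : ℝ) ^ (-lamStar p δ) ≤ Phi p u := by
  have hC0 := pZero_mul_qZero_pos hpos
  have hlam := (le_max_left 1 δ).trans (max_le_lamStar hsum hδ)
  rcases eq_or_ne u [] with rfl | hu
  · have h1 : pZero p * qZero p * (N : ℝ) ^ (-lamStar p δ) ≤ 1 :=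
      mul_le_one₀ (pZero_mul_qZero_lt_one hpos hsum).le (by positivity)
        (rpow_one_le_of_nonpos hN (by linarith))
    simpa [Phi] using h1
  · obtain ⟨hA, hB⟩ := h.lt_Phi_div hpos hsum hδ hN
    have hacc := h.not_accepts hu
    rw [Accepts, not_le] at hacc
    have hN0 : (0 : ℝ) < N := by exact_mod_cast hN
    have hP := Phi_pos hpos u
    have h1 := PsiA_pos hpos u
    have h2 := PsiB_pos hpos u
    have hnum : (pZero p * qZero p * (N : ℝ) ^ (1 - lamStar p δ)) *
        (pZero p * qZero p * (N : ℝ) ^ (δ - lamStar p δ)) =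
        (pZero p * qZero p * (N : ℝ) ^ (-lamStar p δ)) *
          (pZero p * qZero p * (N : ℝ) ^ (1 + δ - lamStar p δ)) := by
      rw [show δ - lamStar p δ = -lamStar p δ + δ by ring, show 1 + δ - lamStar p δ =
        (1 - lamStar p δ) + δ by ring, Real.rpow_add hN0, Real.rpow_add hN0]
      ring
    have hden : Phi p u / PsiA p u * (Phi p u / PsiB p u) = Phi p u * (Phi p u / Psi p u) := by
      rw [Psi]
      field_simp
    have hprod := mul_lt_mul'' hA hB (by positivity) (by positivity)
    rw [hnum, hden] at hprod
    have hq : 0 < Phi p u / Psi p u := div_pos hP (mul_pos h1 h2)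
    by_contra hlt
    push Not at hlt
    have := mul_le_mul hlt.le hacc.le hq.le (by positivity)
    linarith

theorem node_Phi_ge [Nontrivial A] [Nontrivial B] {p : A → B → ℝ}
    (hpos : ∀ i j, 0 < p i j) (hsum : ∑ i, ∑ j, p i j = 1) {δ : ℝ} (hδ : 0 ≤ δ) {N : ℕ}
    (hN : 1 ≤ N) {v : List (A × B)} (h : v ∈ treeNodes p δ N) :
    pZero p * (pZero p * qZero p) * (N : ℝ) ^ (-lamStar p δ) ≤ Phi p v := by
  have hC0 := pZero_mul_qZero_pos hpos
  have hb : ∀ (u : List (A × B)) (x : ℝ), Branches p δ N u → pZero p ≤ x →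
      pZero p * (pZero p * qZero p) * (N : ℝ) ^ (-lamStar p δ) ≤ Phi p u * x := by
    intro u x hu hx
    have := mul_le_mul (hu.le_Phi hpos hsum hδ hN) hx (pZero_pos hpos).le (Phi_pos hpos u).le
    linarith
  rcases h with rfl | ⟨u, e, hu, rfl⟩
  · have hp1 : pZero p ≤ 1 := by
      obtain ⟨i⟩ := (inferInstance : Nonempty A)
      obtain ⟨j⟩ := (inferInstance : Nonempty B)
      exact (pZero_le hpos hsum i j).trans (lt_one_of_pos hpos hsum i j).le
    simpa using hb [] 1 Branches.root hp1
  · rw [Phi_append_singleton]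
    exact hb u _ hu (pZero_le hpos hsum _ _)

/-- The pruning test is known to fail for the parent only; the last letter costs a factor at most
`p₀` in `Φ`, while `Ψ^A` can only shrink. -/
theorem bucket_PsiA_le [Nontrivial A] [Nontrivial B] {p : A → B → ℝ}
    (hpos : ∀ i j, 0 < p i j) (hsum : ∑ i, ∑ j, p i j = 1) {δ : ℝ} (hδ : 0 ≤ δ) {N : ℕ}
    (hN : 1 ≤ N) {v : List (A × B)} (h : v ∈ treeBuckets p δ N) :
    pZero p * (pZero p * qZero p) * (N : ℝ) ^ (1 - lamStar p δ) * PsiA p v ≤ Phi p v := by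
  obtain ⟨u, e, hu, rfl, -⟩ := h
  have h1 := (hu.lt_Phi_div hpos hsum hδ hN).1
  have hA := PsiA_pos hpos u
  rw [lt_div_iff₀ hA] at h1
  have hC0 := pZero_mul_qZero_pos hpos
  have h2 : PsiA p (u ++ [e]) ≤ PsiA p u := by
    simp only [PsiA, List.map_append, List.prod_append, List.map_singleton, List.prod_singleton]
    exact mul_le_of_le_one_right hA.le (margA_le_one hpos hsum _)
  have hp0 := pZero_pos hpos
  rw [Phi_append_singleton]
  calc _ ≤ pZero p * (pZero p * qZero p) * (N : ℝ) ^ (1 - lamStar p δ) * PsiA p u :=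
        mul_le_mul_of_nonneg_left h2 (by positivity)
    _ = (pZero p * qZero p * (N : ℝ) ^ (1 - lamStar p δ) * PsiA p u) * pZero p := by ring
    _ ≤ Phi p u * p e.1 e.2 :=
        mul_le_mul h1.le (pZero_le hpos hsum _ _) hp0.le (Phi_pos hpos u).le

theorem bucket_PsiB_le [Nontrivial A] [Nontrivial B] {p : A → B → ℝ}
    (hpos : ∀ i j, 0 < p i j) (hsum : ∑ i, ∑ j, p i j = 1) {δ : ℝ} (hδ : 0 ≤ δ) {N : ℕ}
    (hN : 1 ≤ N) {v : List (A × B)} (h : v ∈ treeBuckets p δ N) :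
    pZero p * (pZero p * qZero p) * (N : ℝ) ^ (δ - lamStar p δ) * PsiB p v ≤ Phi p v := by
  obtain ⟨u, e, hu, rfl, -⟩ := h
  have h1 := (hu.lt_Phi_div hpos hsum hδ hN).2
  have hA := PsiB_pos hpos u
  rw [lt_div_iff₀ hA] at h1
  have hC0 := pZero_mul_qZero_pos hpos
  have h2 : PsiB p (u ++ [e]) ≤ PsiB p u := by
    simp only [PsiB, List.map_append, List.prod_append, List.map_singleton, List.prod_singleton]
    exact mul_le_of_le_one_right hA.le (margB_le_one hpos hsum _)
  have hp0 := pZero_pos hpos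
  rw [Phi_append_singleton]
  calc _ ≤ pZero p * (pZero p * qZero p) * (N : ℝ) ^ (δ - lamStar p δ) * PsiB p u :=
        mul_le_mul_of_nonneg_left h2 (by positivity)
    _ = (pZero p * qZero p * (N : ℝ) ^ (δ - lamStar p δ) * PsiB p u) * pZero p := by ring
    _ ≤ Phi p u * p e.1 e.2 :=
        mul_le_mul h1.le (pZero_le hpos hsum _ _) hp0.le (Phi_pos hpos u).le

theorem bucket_Psi_le [Nontrivial A] [Nontrivial B] {p : A → B → ℝ}
    (hpos : ∀ i j, 0 < p i j) {δ : ℝ} {N : ℕ} {v : List (A × B)} (h : v ∈ treeBuckets p δ N) :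
    pZero p * qZero p * (N : ℝ) ^ (1 + δ - lamStar p δ) * Psi p v ≤ Phi p v := by
  obtain ⟨u, e, -, rfl, hacc⟩ := h
  exact (le_div_iff₀ (mul_pos (PsiA_pos hpos _) (PsiB_pos hpos _))).1 hacc

/-! ### The depth of the tree -/

/-- `log (1 / max p_ij / p_i^A)`. -/
def gapA (p : A → B → ℝ) : ℝ := Real.log (1 / ⨆ e : A × B, p e.1 e.2 / margA p e.1)

/-- `log (1 / max p_ij / p_j^B)`. -/
def gapB (p : A → B → ℝ) : ℝ := Real.log (1 / ⨆ e : A × B, p e.1 e.2 / margB p e.2)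

theorem log_one_div_ciSup {E : Type*} [Finite E] [Nonempty E] {r : E → ℝ} (h0 : ∀ e, 0 < r e)
    (h1 : ∀ e, r e < 1) :
    0 < Real.log (1 / ⨆ e, r e) ∧ ∀ e, Real.log (r e) ≤ -Real.log (1 / ⨆ e, r e) := by
  obtain ⟨e₀, he₀⟩ := exists_eq_ciSup_of_finite (f := r)
  rw [← he₀, one_div, Real.log_inv, neg_neg]
  refine ⟨by linarith [Real.log_neg (h0 e₀) (h1 e₀)], fun e => Real.log_le_log (h0 e) ?_⟩
  rw [he₀]
  exact le_ciSup (Set.finite_range r).bddAbove e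

theorem gapA_pos [Nontrivial A] [Nontrivial B] {p : A → B → ℝ} (hpos : ∀ i j, 0 < p i j) :
    0 < gapA p :=
  (log_one_div_ciSup (r := fun e : A × B => p e.1 e.2 / margA p e.1)
    (fun _ => div_pos (hpos _ _) (margA_pos hpos _))
    fun _ => (div_lt_one (margA_pos hpos _)).2 (lt_margA hpos _ _)).1

theorem logA_le [Nontrivial A] [Nontrivial B] {p : A → B → ℝ} (hpos : ∀ i j, 0 < p i j)
    (e : A × B) : logA p e ≤ -gapA p :=
  (log_one_div_ciSup (r := fun e : A × B => p e.1 e.2 / margA p e.1)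
    (fun _ => div_pos (hpos _ _) (margA_pos hpos _))
    fun _ => (div_lt_one (margA_pos hpos _)).2 (lt_margA hpos _ _)).2 e

theorem gapB_pos [Nontrivial A] [Nontrivial B] {p : A → B → ℝ} (hpos : ∀ i j, 0 < p i j) :
    0 < gapB p :=
  (log_one_div_ciSup (r := fun e : A × B => p e.1 e.2 / margB p e.2)
    (fun _ => div_pos (hpos _ _) (margB_pos hpos _))
    fun _ => (div_lt_one (margB_pos hpos _)).2 (lt_margB hpos _ _)).1

theorem logB_le [Nontrivial A] [Nontrivial B] {p : A → B → ℝ} (hpos : ∀ i j, 0 < p i j)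
    (e : A × B) : logB p e ≤ -gapB p :=
  (log_one_div_ciSup (r := fun e : A × B => p e.1 e.2 / margB p e.2)
    (fun _ => div_pos (hpos _ _) (margB_pos hpos _))
    fun _ => (div_lt_one (margB_pos hpos _)).2 (lt_margB hpos _ _)).2 e

theorem depthConst_eq (p : A → B → ℝ) (δ : ℝ) : depthConst p δ =
    min ((lamStar p δ - 1) / gapA p) ((lamStar p δ - δ) / gapB p) := rfl

theorem depthConst_nonneg [Nontrivial A] [Nontrivial B] {p : A → B → ℝ}
    (hpos : ∀ i j, 0 < p i j) (hsum : ∑ i, ∑ j, p i j = 1) {δ : ℝ} (hδ : 0 ≤ δ) :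
    0 ≤ depthConst p δ := by
  have hlam := max_le_lamStar hsum hδ
  have h1 := (le_max_left 1 δ).trans hlam
  have h2 := (le_max_right 1 δ).trans hlam
  exact le_min (div_nonneg (by linarith) (gapA_pos hpos).le)
    (div_nonneg (by linarith) (gapB_pos hpos).le)

/-- The additive constant in the bound on the length of branching nodes. -/
def depthSlack (p : A → B → ℝ) : ℝ := -Real.log (pZero p * qZero p) / min (gapA p) (gapB p)

theorem sum_map_le_neg_mul {E : Type*} {h : E → ℝ} {g : ℝ} (hle : ∀ e, h e ≤ -g)
    (v : List E) : (v.map h).sum ≤ -(v.length * g) := by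
  induction v with
  | nil => simp
  | cons e v ih =>
    simp only [List.map_cons, List.sum_cons, List.length_cons]
    push_cast
    linarith [hle e]

/-- Every letter lowers `log (Φ/Ψ^A)` by at least `gapA` and `log (Φ/Ψ^B)` by at least `gapB`, and
both stay above the pruning thresholds; the better of the two bounds gives `c_d`. -/
theorem Branches.length_le [Nontrivial A] [Nontrivial B] {p : A → B → ℝ}
    (hpos : ∀ i j, 0 < p i j) (hsum : ∑ i, ∑ j, p i j = 1) {δ : ℝ} (hδ : 0 ≤ δ) {N : ℕ}
    (hN : 1 ≤ N) {u : List (A × B)} (h : Branches p δ N u) :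
    (u.length : ℝ) ≤ depthConst p δ * Real.log N + depthSlack p := by
  have hN0 : (0 : ℝ) < N := by exact_mod_cast hN
  have hL : 0 ≤ Real.log (N : ℝ) := Real.log_natCast_nonneg N
  have hC0 := pZero_mul_qZero_pos hpos
  have hC : 0 ≤ -Real.log (pZero p * qZero p) := by
    have := Real.log_neg hC0 (pZero_mul_qZero_lt_one hpos hsum)
    linarith
  have hgA := gapA_pos hpos
  have hgB := gapB_pos hpos
  have hg : 0 < min (gapA p) (gapB p) := lt_min hgA hgB
  obtain ⟨h1, h2⟩ := h.lt_Phi_div hpos hsum hδ hN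
  rw [Phi_div_PsiA hpos, ← Real.log_lt_iff_lt_exp (by positivity),
    Real.log_mul hC0.ne' (by positivity), Real.log_rpow hN0] at h1
  rw [Phi_div_PsiB hpos, ← Real.log_lt_iff_lt_exp (by positivity),
    Real.log_mul hC0.ne' (by positivity), Real.log_rpow hN0] at h2
  have h3 := sum_map_le_neg_mul (logA_le hpos) u
  have h4 := sum_map_le_neg_mul (logB_le hpos) u
  have hslackA : -Real.log (pZero p * qZero p) / gapA p ≤ depthSlack p :=
    div_le_div_of_nonneg_left hC hg (min_le_left _ _)
  have hslackB : -Real.log (pZero p * qZero p) / gapB p ≤ depthSlack p :=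
    div_le_div_of_nonneg_left hC hg (min_le_right _ _)
  have hA : (u.length : ℝ) ≤ (lamStar p δ - 1) / gapA p * Real.log N + depthSlack p := by
    have : (u.length : ℝ) ≤
        ((lamStar p δ - 1) * Real.log N + -Real.log (pZero p * qZero p)) / gapA p := by
      rw [le_div_iff₀ hgA]
      linarith
    rw [add_div, mul_div_right_comm] at this
    linarith
  have hB : (u.length : ℝ) ≤ (lamStar p δ - δ) / gapB p * Real.log N + depthSlack p := by
    have : (u.length : ℝ) ≤
        ((lamStar p δ - δ) * Real.log N + -Real.log (pZero p * qZero p)) / gapB p := by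
      rw [le_div_iff₀ hgB]
      linarith
    rw [add_div, mul_div_right_comm] at this
    linarith
  rw [depthConst_eq]
  rcases min_choice ((lamStar p δ - 1) / gapA p) ((lamStar p δ - δ) / gapB p) with h | h <;>
    rw [h] <;> assumption

theorem node_length_le [Nontrivial A] [Nontrivial B] {p : A → B → ℝ}
    (hpos : ∀ i j, 0 < p i j) (hsum : ∑ i, ∑ j, p i j = 1) {δ : ℝ} (hδ : 0 ≤ δ) {N : ℕ}
    (hN : 1 ≤ N) {v : List (A × B)} (h : v ∈ treeNodes p δ N) :
    (v.length : ℝ) ≤ depthConst p δ * Real.log N + depthSlack p + 1 := by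
  rcases h with rfl | ⟨u, e, hu, rfl⟩
  · have := (Branches.root (p := p) (δ := δ) (N := N)).length_le hpos hsum hδ hN
    simp at this ⊢
    linarith
  · have := hu.length_le hpos hsum hδ hN
    simp
    linarith

theorem treeNodes_finite [Nontrivial A] [Nontrivial B] {p : A → B → ℝ}
    (hpos : ∀ i j, 0 < p i j) (hsum : ∑ i, ∑ j, p i j = 1) {δ : ℝ} (hδ : 0 ≤ δ) {N : ℕ}
    (hN : 1 ≤ N) : (treeNodes p δ N).Finite :=
  (List.finite_length_le (A × B)
    ⌊depthConst p δ * Real.log N + depthSlack p + 1⌋₊).subset fun _ hv =>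
      Nat.le_floor (node_length_le hpos hsum hδ hN hv)

theorem length_le_treeDepth [Nontrivial A] [Nontrivial B] {p : A → B → ℝ}
    (hpos : ∀ i j, 0 < p i j) (hsum : ∑ i, ∑ j, p i j = 1) {δ : ℝ} (hδ : 0 ≤ δ) {N : ℕ}
    (hN : 1 ≤ N) {v : List (A × B)} (h : v ∈ treeNodes p δ N) :
    v.length ≤ treeDepth p δ N :=
  le_csSup ((treeNodes_finite hpos hsum hδ hN).image _).bddAbove ⟨v, h, rfl⟩

theorem treeDepth_le [Nontrivial A] [Nontrivial B] {p : A → B → ℝ}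
    (hpos : ∀ i j, 0 < p i j) (hsum : ∑ i, ∑ j, p i j = 1) {δ : ℝ} (hδ : 0 ≤ δ) {N : ℕ}
    (hN : 1 ≤ N) :
    (treeDepth p δ N : ℝ) ≤ depthConst p δ * Real.log N + depthSlack p + 1 := by
  obtain ⟨v, hv, h⟩ := Nat.sSup_mem (s := List.length '' treeNodes p δ N)
    ⟨_, [], Or.inl rfl, rfl⟩ ((treeNodes_finite hpos hsum hδ hN).image _).bddAbove
  rw [treeDepth, ← h]
  exact node_length_le hpos hsum hδ hN hv

/-! ### The number of nodes -/

/-- Leaves have disjoint cylinders of total mass at most 1 and each weighs at least `θ N ^ (-λ*)`.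
All branching being at least binary, leaves make up at least half of the nodes. -/
theorem treeNodes_ncard_le [Nontrivial A] [Nontrivial B] {p : A → B → ℝ}
    (hpos : ∀ i j, 0 < p i j) (hsum : ∑ i, ∑ j, p i j = 1) {δ : ℝ} (hδ : 0 ≤ δ) {N : ℕ}
    (hN : 1 ≤ N) :
    ((treeNodes p δ N).ncard : ℝ) ≤
      2 / (pZero p * (pZero p * qZero p)) * (N : ℝ) ^ lamStar p δ := by
  classical
  have hfin := treeNodes_finite hpos hsum hδ hN
  set V : Finset (List (A × B)) := hfin.toFinset with hV
  have hmemV : ∀ v, v ∈ V ↔ v ∈ treeNodes p δ N := fun v => hfin.mem_toFinset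
  set Br : Finset (List (A × B)) := V.filter fun v => Branches p δ N v with hBr
  set Lf : Finset (List (A × B)) := V.filter fun v => ¬ Branches p δ N v with hLf
  have hsplit : Br.card + Lf.card = V.card := Finset.card_filter_add_card_filter_not _
  -- Appending a letter injects pairs (branching node, letter) into the nodes other than the root,
  -- so twice the number of branching nodes is less than the number of nodes.
  have himg : (Br ×ˢ (Finset.univ : Finset (A × B))).image (fun x => x.1 ++ [x.2]) ⊆
      V.erase [] := by
    intro v hv
    obtain ⟨⟨u, e⟩, hu, rfl⟩ := Finset.mem_image.1 hv
    rw [Finset.mem_product, Finset.mem_filter] at hu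
    exact Finset.mem_erase.2 ⟨by simp, (hmemV _).2 (Or.inr ⟨u, e, hu.1.2, rfl⟩)⟩
  have hcard := Finset.card_le_card himg
  rw [Finset.card_image_of_injective _ (by
      rintro ⟨u, e⟩ ⟨u', e'⟩ h
      have := List.append_inj' h rfl
      simp only [List.cons.injEq, and_true] at this
      exact Prod.ext this.1 this.2), Finset.card_product, Finset.card_univ,
    Finset.card_erase_of_mem ((hmemV _).2 (Or.inl rfl))] at hcard
  have htwo : 2 ≤ Fintype.card (A × B) := by
    have := Fintype.one_lt_card (α := A × B)
    omega
  have hmul : Br.card * 2 ≤ Br.card * Fintype.card (A × B) := Nat.mul_le_mul_left _ htwo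
  have hcardV : V.card ≤ 2 * Lf.card := by omega
  have hmass : ∑ v ∈ Lf, Phi p v ≤ 1 := by
    have hlen : ∀ v ∈ Lf, v.length ≤ treeDepth p δ N := fun v hv =>
      length_le_treeDepth hpos hsum hδ hN ((hmemV v).1 (Finset.mem_filter.1 hv).1)
    have h1 := sum_exists_prefix_eq (sum_prod_type_eq_one hsum) hlen fun v hv w hw h =>
      eq_of_leaf_prefix (Finset.mem_filter.1 hv).2 ((hmemV w).1 (Finset.mem_filter.1 hw).1) h
    change _ = ∑ v ∈ Lf, Phi p v at h1
    rw [← h1]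
    calc _ ≤ ∑ u : Fin (treeDepth p δ N) → A × B, ∏ i, p (u i).1 (u i).2 := by
          refine Finset.sum_le_sum fun u _ => ?_
          split_ifs
          · exact le_rfl
          · exact Finset.prod_nonneg fun i _ => (hpos _ _).le
      _ = 1 := by
          rw [sum_prod_word (fun e : A × B => p e.1 e.2), sum_prod_type_eq_one hsum, one_pow]
  have hN0 : (0 : ℝ) < N := by exact_mod_cast hN
  set θ : ℝ := pZero p * (pZero p * qZero p) with hθ
  have hθ0 : 0 < θ := mul_pos (pZero_pos hpos) (pZero_mul_qZero_pos hpos)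
  have hLfle : (Lf.card : ℝ) * (θ * (N : ℝ) ^ (-lamStar p δ)) ≤ 1 := by
    rw [← nsmul_eq_mul]
    refine (Finset.card_nsmul_le_sum _ _ _ fun v hv => ?_).trans hmass
    exact node_Phi_ge hpos hsum hδ hN ((hmemV v).1 (Finset.mem_filter.1 hv).1)
  rw [Real.rpow_neg hN0.le] at hLfle
  have hNl : (0 : ℝ) < (N : ℝ) ^ lamStar p δ := by positivity
  have h3 : (Lf.card : ℝ) ≤ (N : ℝ) ^ lamStar p δ / θ := by
    rw [le_div_iff₀ hθ0]
    have h4 : (Lf.card : ℝ) * (θ * ((N : ℝ) ^ lamStar p δ)⁻¹) =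
        Lf.card * θ / (N : ℝ) ^ lamStar p δ := by ring
    rw [h4, div_le_one hNl] at hLfle
    exact hLfle
  have h5 : ((treeNodes p δ N).ncard : ℝ) ≤ 2 * Lf.card := by
    rw [Set.ncard_eq_toFinset_card _ hfin]
    exact_mod_cast hcardV
  calc _ ≤ 2 * ((N : ℝ) ^ lamStar p δ / θ) := by linarith
    _ = _ := by ring

/-! ### The mass of the buckets -/

/-- Every word of the type `⌊s log N⌋`, with `s` the optimal type, has a bucket as a prefix, so the
bucket mass is at least the probability of the type class. The error is expressed through the mass
`T` of `s log N` so that it can be traded against `c_d log N`. -/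
theorem bucket_mass_ge [Nontrivial A] [Nontrivial B] {p : A → B → ℝ}
    (hpos : ∀ i j, 0 < p i j) (hsum : ∑ i, ∑ j, p i j = 1) {δ : ℝ} (hδ : 0 ≤ δ) {N : ℕ}
    (hN : 1 ≤ N) {W : Finset (List (A × B))} (hW : ∀ v, v ∈ W ↔ v ∈ treeBuckets p δ N) :
    ∃ T : ℝ, 0 ≤ T ∧ T ≤ depthConst p δ * Real.log N ∧
      Real.exp (-((lamStar p δ - max 1 δ) * Real.log N) -
        Fintype.card (A × B) * (3 + 2 * Real.log (T + 1))) ≤ ∑ v ∈ W, Phi p v := by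
  classical
  have hN0 : (0 : ℝ) < N := by exact_mod_cast hN
  set L : ℝ := Real.log N with hLdef
  have hL : 0 ≤ L := Real.log_natCast_nonneg N
  have hrpow : ∀ x : ℝ, (N : ℝ) ^ x = Real.exp (x * L) := fun x => by
    rw [Real.rpow_def_of_pos hN0, mul_comm]
  obtain ⟨s, hs0, hsZ, hsX, hsY, hsD⟩ := exists_optimal_type hpos hsum hδ
  have hpE : ∀ e : A × B, 0 < p e.1 e.2 := fun e => hpos _ _
  have hpE1 : ∀ e : A × B, p e.1 e.2 ≤ 1 := fun e => (lt_one_of_pos hpos hsum _ _).le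
  set x : A × B → ℝ := L • s with hx
  have hx0 : ∀ e, 0 ≤ x e := fun e => mul_nonneg hL (hs0 e)
  have hxsum : ∀ h : A × B → ℝ, ∑ e, x e * h e = L * ∑ e, s e * h e := fun h => by
    rw [Finset.mul_sum]
    exact Finset.sum_congr rfl fun e _ => mul_assoc _ _ _
  set k : A × B → ℕ := fun e => ⌊x e⌋₊ with hk
  have hkx : ∀ e, (k e : ℝ) ≤ x e := fun e => Nat.floor_le (hx0 e)
  set n : ℕ := ∑ e, k e with hn
  set T : ℝ := ∑ e, x e with hT
  have hT0 : 0 ≤ T := Finset.sum_nonneg fun e _ => hx0 e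
  have hnT : (n : ℝ) ≤ T := by
    rw [hn, Nat.cast_sum]
    exact Finset.sum_le_sum fun e _ => hkx e
  -- `logA` and `logB` are negative, so rounding down only helps the two pruning conditions.
  have hkX : -((lamStar p δ - 1) * L) ≤ ∑ e, (k e : ℝ) * logA p e := by
    have h1 : ∑ e, x e * logA p e ≤ ∑ e, (k e : ℝ) * logA p e :=
      Finset.sum_le_sum fun e _ => mul_le_mul_of_nonpos_right (hkx e) (logA_neg hpos e).le
    rw [hxsum] at h1
    have := mul_le_mul_of_nonneg_left hsX hL
    linarith
  have hkY : -((lamStar p δ - δ) * L) ≤ ∑ e, (k e : ℝ) * logB p e := by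
    have h1 : ∑ e, x e * logB p e ≤ ∑ e, (k e : ℝ) * logB p e :=
      Finset.sum_le_sum fun e _ => mul_le_mul_of_nonpos_right (hkx e) (logB_neg hpos e).le
    rw [hxsum] at h1
    have := mul_le_mul_of_nonneg_left hsY hL
    linarith
  have hqpos : ∀ e : A × B, 0 < margA p e.1 * margB p e.2 := fun e =>
    mul_pos (margA_pos hpos _) (margB_pos hpos _)
  -- `logAB` may be positive, and then rounding loses up to `-log q_ij` per letter; the product of
  -- the `q_ij` is absorbed by `q₀` in the acceptance threshold.
  have hkZ : (1 + δ - lamStar p δ) * L + ∑ e : A × B, Real.log (margA p e.1 * margB p e.2) ≤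
      ∑ e, (k e : ℝ) * logAB p e := by
    have h1 : ∑ e : A × B, (x e * logAB p e + Real.log (margA p e.1 * margB p e.2)) ≤
        ∑ e, (k e : ℝ) * logAB p e := by
      refine Finset.sum_le_sum fun e _ => ?_
      have hq1 : Real.log (margA p e.1 * margB p e.2) ≤ 0 := Real.log_nonpos (hqpos e).le
        (mul_le_one₀ (margA_le_one hpos hsum _) (margB_pos hpos _).le (margB_le_one hpos hsum _))
      have hz : logAB p e ≤ -Real.log (margA p e.1 * margB p e.2) := by
        rw [logAB, Real.log_div (hpE e).ne' (hqpos e).ne']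
        linarith [Real.log_nonpos (hpE e).le (hpE1 e)]
      have hf1 : x e - k e ≤ 1 := by linarith [Nat.lt_floor_add_one (x e)]
      have hf0 : 0 ≤ x e - k e := by linarith [hkx e]
      have : (x e - k e) * logAB p e ≤ -Real.log (margA p e.1 * margB p e.2) := by
        calc (x e - k e) * logAB p e
            ≤ (x e - k e) * -Real.log (margA p e.1 * margB p e.2) :=
              mul_le_mul_of_nonneg_left hz hf0
          _ ≤ _ := mul_le_of_le_one_left (by linarith) hf1
      linarith
    rw [Finset.sum_add_distrib, hxsum] at h1
    have := mul_le_mul_of_nonneg_left hsZ hL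
    linarith
  have hC0 := pZero_mul_qZero_pos hpos
  have hC1 := pZero_mul_qZero_lt_one hpos hsum
  have hq0 : qZero p * (N : ℝ) ^ (1 + δ - lamStar p δ) ≤
      Real.exp (∑ e, (k e : ℝ) * logAB p e) := by
    calc qZero p * (N : ℝ) ^ (1 + δ - lamStar p δ)
        ≤ (∏ e : A × B, margA p e.1 * margB p e.2) * (N : ℝ) ^ (1 + δ - lamStar p δ) :=
          mul_le_mul_of_nonneg_right (qZero_le_prod p) (by positivity)
      _ = Real.exp ((1 + δ - lamStar p δ) * L +
            ∑ e : A × B, Real.log (margA p e.1 * margB p e.2)) := by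
          rw [Real.exp_add, Real.exp_sum, ← hrpow, mul_comm]
          congr 1
          exact Finset.prod_congr rfl fun e _ => (Real.exp_log (hqpos e)).symm
      _ ≤ _ := Real.exp_le_exp.2 hkZ
  have hp01 : pZero p ≤ 1 := by
    obtain ⟨i⟩ := (inferInstance : Nonempty A)
    obtain ⟨j⟩ := (inferInstance : Nonempty B)
    exact (pZero_le hpos hsum i j).trans (lt_one_of_pos hpos hsum i j).le
  have hlam := max_le_lamStar hsum hδ
  have hlog1 : 0 ≤ Real.log (T + 1) := Real.log_nonneg (by linarith)
  have hcard0 : (0 : ℝ) ≤ Fintype.card (A × B) := Nat.cast_nonneg _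
  have hf1 := sum_prod_type_eq_one hsum
  refine ⟨T, hT0, ?_, ?_⟩
  -- Each unit of mass uses up at least `gapA`, respectively `gapB`, of the budget in the linear
  -- constraints.
  · have hTA : T * gapA p ≤ (lamStar p δ - 1) * L := by
      have : ∑ e, x e * logA p e ≤ ∑ e, x e * -gapA p :=
        Finset.sum_le_sum fun e _ => mul_le_mul_of_nonneg_left (logA_le hpos e) (hx0 e)
      rw [hxsum, ← Finset.sum_mul, ← hT] at this
      have := mul_le_mul_of_nonneg_left hsX hL
      linarith
    have hTB : T * gapB p ≤ (lamStar p δ - δ) * L := by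
      have : ∑ e, x e * logB p e ≤ ∑ e, x e * -gapB p :=
        Finset.sum_le_sum fun e _ => mul_le_mul_of_nonneg_left (logB_le hpos e) (hx0 e)
      rw [hxsum, ← Finset.sum_mul, ← hT] at this
      have := mul_le_mul_of_nonneg_left hsY hL
      linarith
    rw [← le_div_iff₀ (gapA_pos hpos), mul_div_right_comm] at hTA
    rw [← le_div_iff₀ (gapB_pos hpos), mul_div_right_comm] at hTB
    rw [depthConst_eq]
    rcases min_choice ((lamStar p δ - 1) / gapA p) ((lamStar p δ - δ) / gapB p) with h | h <;>
      rw [h] <;> assumption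
  -- If the type rounds to the empty word, the root would be the witness, but it is no bucket. Then
  -- `q₀ N ^ (1 + δ - λ*) ≤ 1`, so `p₀` makes all its children buckets and the mass is 1.
  rcases Nat.eq_zero_or_pos n with hn0 | hnpos
  · have hk0 : ∀ e, k e = 0 := fun e => (Finset.sum_eq_zero_iff.1 hn0) e (Finset.mem_univ e)
    simp only [hk0, Nat.cast_zero, zero_mul, Finset.sum_const_zero, Real.exp_zero] at hq0
    have hall : ∀ e : A × B, [e] ∈ W := by
      intro e
      refine (hW _).2 ⟨[], e, Branches.root, rfl, ?_⟩
      rw [Accepts]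
      have h1 : Phi p [e] / Psi p [e] = p e.1 e.2 / (margA p e.1 * margB p e.2) := by
        simp [Phi, Psi, PsiA, PsiB]
      rw [h1, le_div_iff₀ (hqpos e)]
      calc _ ≤ pZero p * (qZero p * (N : ℝ) ^ (1 + δ - lamStar p δ)) * 1 := by
            rw [mul_assoc (pZero p)]
            have := qZero_pos hpos
            have := pZero_pos hpos
            exact mul_le_mul_of_nonneg_left
              (mul_le_one₀ (margA_le_one hpos hsum _) (margB_pos hpos _).le
                (margB_le_one hpos hsum _)) (by positivity)
        _ ≤ pZero p := by
            rw [mul_one]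
            exact mul_le_of_le_one_right (pZero_pos hpos).le hq0
        _ ≤ _ := pZero_le hpos hsum _ _
    have h1 := sum_exists_prefix_le (fun e => (hpE e).le) hf1 1 W
    have h2 : 1 ≤ ∑ v ∈ W, Phi p v := by
      refine le_trans (le_of_eq ?_) h1
      rw [← one_pow 1, ← hf1, ← sum_prod_word (fun e : A × B => p e.1 e.2)]
      refine Finset.sum_congr rfl fun u _ => (if_pos ⟨[u 0], hall _, ?_⟩).symm
      simp
    refine le_trans (Real.exp_le_one_iff.2 ?_) h2
    have := mul_nonneg (sub_nonneg.2 hlam) hL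
    have : 0 ≤ (Fintype.card (A × B) : ℝ) * (3 + 2 * Real.log (T + 1)) :=
      mul_nonneg hcard0 (by linarith)
    linarith
  · have hprefix : ∀ u : Fin n → A × B,
        (∀ h : A × B → ℝ, ((List.ofFn u).map h).sum = ∑ e, (k e : ℝ) * h e) →
        ∃ v ∈ W, v <+: List.ofFn u := by
      intro u hsumk
      obtain ⟨w, hw, hwu⟩ := exists_bucket_prefix hpos (δ := δ) (N := N) (v := List.ofFn u)
        (by
          rw [Ne, List.ofFn_eq_nil_iff]
          omega)
        (by
          rw [Accepts, Phi_div_Psi hpos, hsumk, mul_assoc]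
          refine (mul_le_of_le_one_left ?_ hp01).trans hq0
          have := qZero_pos hpos
          positivity)
        (by
          rw [Prunes, Phi_div_PsiA hpos, Phi_div_PsiB hpos, hsumk, hsumk, not_or, not_le, not_le,
            hrpow, hrpow]
          constructor
          · refine lt_of_lt_of_le (mul_lt_of_lt_one_left (Real.exp_pos _) hC1)
              (Real.exp_le_exp.2 ?_)
            linarith
          · refine lt_of_lt_of_le (mul_lt_of_lt_one_left (Real.exp_pos _) hC1)
              (Real.exp_le_exp.2 ?_)
            linarith)
      exact ⟨w, (hW w).2 hw, hwu⟩
    have h2 := sum_exists_prefix_le (fun e => (hpE e).le) hf1 n W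
    refine le_trans (Real.exp_le_exp.2 ?_)
      ((prob_ge_of_forall_type hpE (k := k) rfl _ hprefix).trans h2)
    have h3 := relEntropy_floor_le hpE hpE1 hx0
    have h4 : relEntropy (fun e : A × B => p e.1 e.2) x ≤ (lamStar p δ - max 1 δ) * L := by
      rw [hx, relEntropy_smul _ hL]
      have := mul_le_mul_of_nonneg_left hsD hL
      linarith
    have h5 : Real.log ((n : ℝ) + 1) ≤ Real.log (T + 1) :=
      Real.log_le_log (by positivity) (by linarith)
    have h6 := mul_le_mul_of_nonneg_left h5 hcard0
    rw [← hT] at h3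
    change relEntropy _ (fun e => (k e : ℝ)) ≤ _ at h3
    linarith

/-- The bucket mass, with the polynomial factor absorbed into an arbitrarily small exponent. -/
theorem exists_bucket_mass_ge [Nontrivial A] [Nontrivial B] {p : A → B → ℝ}
    (hpos : ∀ i j, 0 < p i j) (hsum : ∑ i, ∑ j, p i j = 1) {δ : ℝ} (hδ : 0 ≤ δ) {κ : ℝ}
    (hκ : 0 < κ) :
    ∃ C > 0, ∀ N : ℕ, 1 ≤ N → ∀ W : Finset (List (A × B)),
      (∀ v, v ∈ W ↔ v ∈ treeBuckets p δ N) →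
      C * (N : ℝ) ^ (max 1 δ - lamStar p δ - depthConst p δ * κ) ≤ ∑ v ∈ W, Phi p v := by
  set m : ℝ := (Fintype.card (A × B) : ℝ) with hm
  have hm0 : 0 < m := by
    rw [hm]
    exact_mod_cast Fintype.card_pos
  -- With this slope, `log (T + 1) ≤ r (T + 1) - 1 - log r` turns `2 m log (T + 1)` into `κ T` plus
  -- a constant, and `T ≤ c_d log N`.
  set r : ℝ := κ / (2 * m) with hr
  have hr0 : 0 < r := by positivity
  refine ⟨Real.exp (-(m * (3 + 2 * (r - 1 - Real.log r)))), Real.exp_pos _, ?_⟩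
  intro N hN W hW
  obtain ⟨T, hT0, hT, h⟩ := bucket_mass_ge hpos hsum hδ hN hW
  refine le_trans ?_ h
  have hN0 : (0 : ℝ) < N := by exact_mod_cast hN
  rw [Real.rpow_def_of_pos hN0, ← Real.exp_add, Real.exp_le_exp]
  have h1 := Real.log_le_sub_one_of_pos (show 0 < (T + 1) * r by positivity)
  rw [Real.log_mul (by positivity) hr0.ne'] at h1
  have h2 : 2 * m * (T * r) = κ * T := by
    rw [hr]
    field_simp
  have h3 := mul_le_mul_of_nonneg_left hT hκ.le
  have h4 := mul_le_mul_of_nonneg_left h1 (show 0 ≤ 2 * m by positivity)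
  linarith

/-! ### Independence of disjoint blocks of coordinates -/

theorem sum_pi_prod {ι κ : Type*} [Fintype ι] [DecidableEq ι] [Fintype κ] (g : ι → κ → ℝ) :
    ∑ u : ι → κ, ∏ i, g i (u i) = ∏ i, ∑ x, g i x := by
  rw [Finset.prod_univ_sum (fun _ => Finset.univ) g, Fintype.piFinset_univ]

/-- Coordinates outside the blocks sum out to 1 and the injectively placed blocks factor, which is
the independence of the bands. -/
theorem sum_block_prod {α β γ ι : Type*} [Fintype α] [Fintype β] [Fintype γ] [Fintype ι]
    [DecidableEq β] [DecidableEq γ] [DecidableEq ι] {f : α → ℝ} (hf1 : ∑ x, f x = 1)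
    {j : β × γ → ι} (hj : Function.Injective j) (H : (γ → α) → ℝ) :
    ∑ w : ι → α, (∏ s, f (w s)) * ∏ z, H (fun i => w (j (z, i))) =
      (∑ u : γ → α, (∏ i, f (u i)) * H u) ^ Fintype.card β := by
  classical
  let e : (β × γ) ⊕ ((Set.range j)ᶜ : Set ι) ≃ ι :=
    ((Equiv.ofInjective j hj).sumCongr (Equiv.refl _)).trans (Equiv.Set.sumCompl (Set.range j))
  have he : ∀ x, e (Sum.inl x) = j x := fun x => by
    simp [e]
  let E : (β → γ → α) × (((Set.range j)ᶜ : Set ι) → α) ≃ (ι → α) :=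
    ((Equiv.prodCongr (Equiv.curry β γ α).symm (Equiv.refl _)).trans
      (Equiv.sumArrowEquivProdArrow (β × γ) ((Set.range j)ᶜ : Set ι) α).symm).trans
        (Equiv.arrowCongr e (Equiv.refl α))
  have hE1 : ∀ u x, E u (e (Sum.inl x)) = u.1 x.1 x.2 := fun u x => by
    simp [E, Equiv.sumArrowEquivProdArrow, Function.uncurry]
  have hE2 : ∀ u x, E u (e (Sum.inr x)) = u.2 x := fun u x => by
    simp [E, Equiv.sumArrowEquivProdArrow]
  rw [← E.sum_comp, Fintype.sum_prod_type]
  have hterm : ∀ u₁ u₂, (∏ s, f (E (u₁, u₂) s)) * ∏ z, H (fun i => E (u₁, u₂) (j (z, i))) =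
      (∏ z, ((∏ i, f (u₁ z i)) * H (u₁ z))) * ∏ x, f (u₂ x) := by
    intro u₁ u₂
    rw [← Equiv.prod_comp e, Fintype.prod_sum_type, Fintype.prod_prod_type,
      Finset.prod_mul_distrib]
    simp only [← he, hE1, hE2]
    ring
  simp only [hterm, ← Finset.mul_sum]
  rw [sum_pi_prod fun _ => f, hf1, Finset.prod_const_one]
  simp only [mul_one]
  rw [sum_pi_prod fun (_ : β) (u : γ → α) => (∏ i, f (u i)) * H u, Finset.prod_const,
    Finset.card_univ]

theorem exists_perm_extending {α β : Type*} [Finite β] {c φ : α → β}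
    (hc : Function.Injective c) (hφ : Function.Injective φ) :
    ∃ σ : Equiv.Perm β, ∀ i, σ (c i) = φ i := by
  classical
  refine ⟨((Equiv.ofInjective c hc).symm.trans (Equiv.ofInjective φ hφ)).extendSubtype,
    fun i => ?_⟩
  rw [Equiv.extendSubtype_apply_of_mem _ _ ⟨i, rfl⟩]
  simp

/-- Permutations which move pairwise disjoint blocks of `d` coordinates to the front. -/
theorem exists_block_perms {b d S : ℕ} (hbd : b * d ≤ S) (hd : d ≤ S) :
    ∃ (j : Fin b × Fin d → Fin S) (perm : Fin b → Equiv.Perm (Fin S)), Function.Injective j ∧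
      ∀ z i, perm z (Fin.castLE hd i) = j (z, i) := by
  let j : Fin b × Fin d → Fin S := fun x => Fin.castLE hbd (finProdFinEquiv x)
  have hj : Function.Injective j :=
    (Fin.castLE_injective hbd).comp finProdFinEquiv.injective
  have h := fun z : Fin b => exists_perm_extending (Fin.castLE_injective hd)
    (φ := fun i => j (z, i)) fun i i' hii => (Prod.ext_iff.1 (hj hii)).2
  choose perm hperm using h
  exact ⟨j, perm, hj, hperm⟩

theorem prefix_ofFn_iff {α : Type*} {d S : ℕ} (hd : d ≤ S) (g : Fin S → α) {v : List α}
    (hv : v.length ≤ d) :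
    v <+: List.ofFn g ↔ v <+: List.ofFn fun i : Fin d => g (Fin.castLE hd i) := by
  have h : (List.ofFn fun i : Fin d => g (Fin.castLE hd i)) <+: List.ofFn g := by
    obtain ⟨r, rfl⟩ := Nat.exists_eq_add_of_le hd
    rw [List.ofFn_add]
    exact List.prefix_append _ _
  refine ⟨fun hvg => List.prefix_of_prefix_length_le hvg h (by simpa using hv),
    fun hvg => hvg.trans h⟩

theorem prefix_iff_map_fst_snd {A B : Type*} {v l : List (A × B)} :
    v <+: l ↔ v.map Prod.fst <+: l.map Prod.fst ∧ v.map Prod.snd <+: l.map Prod.snd := by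
  refine ⟨fun h => ⟨h.map _, h.map _⟩, ?_⟩
  rintro ⟨h1, h2⟩
  induction v generalizing l with
  | nil => exact List.nil_prefix
  | cons e v ih =>
    cases l with
    | nil => simp at h1
    | cons e' l =>
      simp only [List.map_cons, List.cons_prefix_cons] at h1 h2 ⊢
      exact ⟨Prod.ext h1.1 h2.1, ih h1.2 h2.2⟩

/-- The two coordinate lists of `v` have equal length, so a collision in `v` is a single prefix
event for the word of pairs. Its probability is then governed by `Φ(v)` for a true pair and by
`Ψ(v)` for a random one. -/
theorem mem_hashA_inter_hashB_iff {A B : Type*} {S : ℕ} {W : Set (List (A × B))}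
    {σ : Equiv.Perm (Fin S)} {w : Fin S → A × B} {v : List (A × B)} :
    v ∈ hashA W σ (fun s => (w s).1) ∩ hashB W σ (fun s => (w s).2) ↔
      v ∈ W ∧ v <+: List.ofFn fun s => w (σ s) := by
  rw [prefix_iff_map_fst_snd, List.map_ofFn, List.map_ofFn]
  constructor
  · rintro ⟨⟨h1, h2⟩, -, h3⟩
    exact ⟨h1, h2, h3⟩
  · rintro ⟨h1, h2, h3⟩
    exact ⟨⟨h1, h2⟩, h1, h3⟩

/-! ### Expectations under a data law -/

open Classical in
theorem sum_law_mul_comp {S N M : ℕ} (law : DataSet A B S N M → ℝ) {β : Type*} [Fintype β]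
    (T : DataSet A B S N M → β) (g : β → ℝ) :
    ∑ D, law D * g (T D) = ∑ x, prob law {D | T D = x} * g x := by
  simp only [prob, Finset.sum_mul]
  rw [Finset.sum_comm]
  refine Finset.sum_congr rfl fun D _ => ?_
  rw [Finset.sum_eq_single (T D)]
  · rw [Set.indicator_of_mem (by rfl)]
  · intro x _ hx
    rw [Set.indicator_of_notMem (fun h => hx h.symm), zero_mul]
  · simp

theorem sum_law_pair {S N M : ℕ} {law : DataSet A B S N M → ℝ} {f : A × B → ℝ} {n : Fin N}
    {m : Fin M}
    (hlaw : ∀ x y, prob law {D | D.1 n = x ∧ D.2 m = y} = ∏ s, f (x s, y s))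
    (g : (Fin S → A) → (Fin S → B) → ℝ) :
    ∑ D, law D * g (D.1 n) (D.2 m) =
      ∑ w : Fin S → A × B, (∏ s, f (w s)) * g (fun s => (w s).1) (fun s => (w s).2) := by
  have h := sum_law_mul_comp law (fun D => (D.1 n, D.2 m)) fun x => g x.1 x.2
  simp only at h
  rw [h, ← (Equiv.arrowProdEquivProdArrow (Fin S) (fun _ => A) (fun _ => B)).sum_comp]
  refine Finset.sum_congr rfl fun w _ => ?_
  have hset : {D : DataSet A B S N M | (D.1 n, D.2 m) =
      Equiv.arrowProdEquivProdArrow (Fin S) (fun _ => A) (fun _ => B) w} =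
      {D | D.1 n = (fun s => (w s).1) ∧ D.2 m = fun s => (w s).2} := by
    ext D
    simp [Equiv.arrowProdEquivProdArrow, Prod.ext_iff]
  rw [hset, hlaw]
  rfl

theorem ncard_eq_sum_ite {E : Type*} {W : Finset E} {s : Set E} {Q : E → Prop}
    {_ : DecidablePred Q} (h : ∀ v, v ∈ s ↔ v ∈ W ∧ Q v) : (s.ncard : ℝ) = ∑ v ∈ W, if Q v then (1 : ℝ) else 0 := by
  have : s = ((W.filter Q : Finset E) : Set E) := by
    ext v
    simp [h]
  rw [this, Set.ncard_coe_finset, Finset.card_filter]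
  push_cast
  rfl

open Classical in
-- Linearity of expectation; there is only an inequality because nodes longer than `S` never match.
-- The labelling `ℓ` serves class words, query words and pair words alike.
theorem sum_weight_mul_prefix_count_le {α E : Type*} [Fintype α] {f : α → ℝ}
    (hf0 : ∀ x, 0 ≤ f x) (hf1 : ∑ x, f x = 1) {S : ℕ} (σ : Equiv.Perm (Fin S)) (W : Finset E)
    (ℓ : E → List α) :
    ∑ w : Fin S → α, (∏ s, f (w s)) *
        ∑ v ∈ W, (if ℓ v <+: List.ofFn (fun s => w (σ s)) then (1 : ℝ) else 0) ≤
      ∑ v ∈ W, ((ℓ v).map f).prod := by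
  simp only [Finset.mul_sum, mul_ite, mul_one, mul_zero]
  rw [Finset.sum_comm]
  refine Finset.sum_le_sum fun v _ => ?_
  rw [sum_prefix_weight_perm hf1 σ (ℓ v)]
  split_ifs
  · exact le_rfl
  · refine List.prod_nonneg fun x hx => ?_
    obtain ⟨y, -, rfl⟩ := List.mem_map.1 hx
    exact hf0 y

section Hashing

variable {p : A → B → ℝ} {S N M : ℕ} {partner : Fin M → Option (Fin N)}
  {law : DataSet A B S N M → ℝ}

theorem expect_hashA_le [Nonempty B] (hpos : ∀ i j, 0 < p i j) (hsum : ∑ i, ∑ j, p i j = 1)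
    (hlaw : IsDataLaw p partner law) (W : Finset (List (A × B))) (σ : Equiv.Perm (Fin S))
    (n : Fin N) :
    ∑ D, law D * ((hashA (W : Set (List (A × B))) σ (D.1 n)).ncard : ℝ) ≤
      ∑ v ∈ W, PsiA p v := by
  classical
  rw [sum_law_mul_comp law (fun D => D.1 n)
    fun x => ((hashA (W : Set (List (A × B))) σ x).ncard : ℝ)]
  have h := sum_weight_mul_prefix_count_le (fun i => (margA_pos hpos i).le) hsum σ W
    (List.map Prod.fst)
  simp only [List.map_map] at h
  refine le_trans (le_of_eq ?_) h
  refine Finset.sum_congr rfl fun x _ => ?_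
  rw [hlaw.class_law]
  exact congrArg _ (ncard_eq_sum_ite fun v => Iff.rfl)

theorem expect_hashB_le [Nonempty A] (hpos : ∀ i j, 0 < p i j) (hsum : ∑ i, ∑ j, p i j = 1)
    (hlaw : IsDataLaw p partner law) (W : Finset (List (A × B))) (σ : Equiv.Perm (Fin S))
    (m : Fin M) :
    ∑ D, law D * ((hashB (W : Set (List (A × B))) σ (D.2 m)).ncard : ℝ) ≤
      ∑ v ∈ W, PsiB p v := by
  classical
  rw [sum_law_mul_comp law (fun D => D.2 m)
    fun x => ((hashB (W : Set (List (A × B))) σ x).ncard : ℝ)]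
  have h := sum_weight_mul_prefix_count_le (fun i => (margB_pos hpos i).le)
    ((sum_margB p).trans hsum) σ W (List.map Prod.snd)
  simp only [List.map_map] at h
  refine le_trans (le_of_eq ?_) h
  refine Finset.sum_congr rfl fun x _ => ?_
  rw [hlaw.query_law]
  exact congrArg _ (ncard_eq_sum_ite fun v => Iff.rfl)

theorem expect_inter_le {f : A × B → ℝ} (hf0 : ∀ e, 0 ≤ f e) (hf1 : ∑ e, f e = 1)
    {n : Fin N} {m : Fin M}
    (hlaw : ∀ x y, prob law {D | D.1 n = x ∧ D.2 m = y} = ∏ s, f (x s, y s))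
    (W : Finset (List (A × B))) (σ : Equiv.Perm (Fin S)) :
    ∑ D, law D * ((hashA (W : Set (List (A × B))) σ (D.1 n) ∩
      hashB (W : Set (List (A × B))) σ (D.2 m)).ncard : ℝ) ≤ ∑ v ∈ W, (v.map f).prod := by
  classical
  rw [sum_law_pair hlaw fun x y => ((hashA (W : Set (List (A × B))) σ x ∩
      hashB (W : Set (List (A × B))) σ y).ncard : ℝ)]
  have h := sum_weight_mul_prefix_count_le hf0 hf1 σ W id
  simp only [id] at h
  refine le_trans (le_of_eq ?_) h
  exact Finset.sum_congr rfl fun w _ =>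
    congrArg _ (ncard_eq_sum_ite fun v => mem_hashA_inter_hashB_iff)

/-- The cost is a sum of functions of one point or one pair, so only the one- and two-point laws
enter and no joint independence of the data is needed. -/
theorem expect_runCost_le [Nonempty A] [Nonempty B] (hpos : ∀ i j, 0 < p i j)
    (hsum : ∑ i, ∑ j, p i j = 1) (hlaw : IsDataLaw p partner law) (c : UnitCosts)
    (V : Set (List (A × B))) (W : Finset (List (A × B))) {b : ℕ}
    (perm : Fin b → Equiv.Perm (Fin S)) :
    expect law (runCost c V (W : Set (List (A × B))) perm) ≤
      c.tree * V.ncard + c.hash * (b * N + b * M) +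
        c.insertion * (b * (N * ∑ v ∈ W, PsiA p v) + b * (M * ∑ v ∈ W, PsiB p v)) +
        c.pos * (b * (N * M * ∑ v ∈ W, Psi p v + M * ∑ v ∈ W, Phi p v)) := by
  classical
  set W' : Set (List (A × B)) := (W : Set (List (A × B))) with hW'
  have hexp : expect law (runCost c V W' perm) =
      c.tree * V.ncard + c.hash * (b * N + b * M) +
        c.insertion * ((∑ z, ∑ n, ∑ D, law D * ((hashA W' (perm z) (D.1 n)).ncard : ℝ)) +
          ∑ z, ∑ m, ∑ D, law D * ((hashB W' (perm z) (D.2 m)).ncard : ℝ)) +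
        c.pos * ∑ z, ∑ n, ∑ m, ∑ D,
          law D * ((hashA W' (perm z) (D.1 n) ∩ hashB W' (perm z) (D.2 m)).ncard : ℝ) := by
    have h1 : ∀ x : ℝ, ∑ D, law D * x = x := fun x => by
      rw [← Finset.sum_mul, hlaw.sum_eq_one, one_mul]
    have hA : ∑ D, law D * (∑ z, ∑ n, ((hashA W' (perm z) (D.1 n)).ncard : ℝ)) =
        ∑ z, ∑ n, ∑ D, law D * ((hashA W' (perm z) (D.1 n)).ncard : ℝ) := by
      simp only [Finset.mul_sum]
      rw [Finset.sum_comm]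
      exact Finset.sum_congr rfl fun z _ => Finset.sum_comm
    have hB : ∑ D, law D * (∑ z, ∑ m, ((hashB W' (perm z) (D.2 m)).ncard : ℝ)) =
        ∑ z, ∑ m, ∑ D, law D * ((hashB W' (perm z) (D.2 m)).ncard : ℝ) := by
      simp only [Finset.mul_sum]
      rw [Finset.sum_comm]
      exact Finset.sum_congr rfl fun z _ => Finset.sum_comm
    have hAB : ∑ D, law D * (∑ z, ∑ n, ∑ m,
        ((hashA W' (perm z) (D.1 n) ∩ hashB W' (perm z) (D.2 m)).ncard : ℝ)) =
        ∑ z, ∑ n, ∑ m, ∑ D, law D *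
          ((hashA W' (perm z) (D.1 n) ∩ hashB W' (perm z) (D.2 m)).ncard : ℝ) := by
      simp only [Finset.mul_sum]
      rw [Finset.sum_comm]
      refine Finset.sum_congr rfl fun z _ => ?_
      rw [Finset.sum_comm]
      exact Finset.sum_congr rfl fun n _ => Finset.sum_comm
    rw [← hA, ← hB, ← hAB]
    simp only [expect, runCost, mul_add, Finset.sum_add_distrib, h1]
    simp only [mul_left_comm _ c.insertion, mul_left_comm _ c.pos, ← Finset.mul_sum]
  rw [hexp]
  have hA : (∑ z, ∑ n, ∑ D, law D * ((hashA W' (perm z) (D.1 n)).ncard : ℝ)) ≤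
      b * (N * ∑ v ∈ W, PsiA p v) := by
    calc _ ≤ ∑ _z : Fin b, ∑ _n : Fin N, ∑ v ∈ W, PsiA p v :=
          Finset.sum_le_sum fun z _ => Finset.sum_le_sum fun n _ =>
            expect_hashA_le hpos hsum hlaw W (perm z) n
      _ = _ := by simp
  have hB : (∑ z, ∑ m, ∑ D, law D * ((hashB W' (perm z) (D.2 m)).ncard : ℝ)) ≤
      b * (M * ∑ v ∈ W, PsiB p v) := by
    calc _ ≤ ∑ _z : Fin b, ∑ _m : Fin M, ∑ v ∈ W, PsiB p v :=
          Finset.sum_le_sum fun z _ => Finset.sum_le_sum fun m _ =>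
            expect_hashB_le hpos hsum hlaw W (perm z) m
      _ = _ := by simp
  have hPsi0 : 0 ≤ ∑ v ∈ W, Psi p v := Finset.sum_nonneg fun v _ =>
    (mul_pos (PsiA_pos hpos v) (PsiB_pos hpos v)).le
  have hPhi0 : 0 ≤ ∑ v ∈ W, Phi p v := Finset.sum_nonneg fun v _ => (Phi_pos hpos v).le
  have hAB : (∑ z, ∑ n, ∑ m, ∑ D, law D *
      ((hashA W' (perm z) (D.1 n) ∩ hashB W' (perm z) (D.2 m)).ncard : ℝ)) ≤
      b * (N * M * ∑ v ∈ W, Psi p v + M * ∑ v ∈ W, Phi p v) := by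
    -- The random rate is charged to all `N M` pairs, and the true rate on top of it at most once
    -- per query.
    calc _ ≤ ∑ _z : Fin b, ∑ n : Fin N, ∑ m : Fin M,
          (∑ v ∈ W, Psi p v + if partner m = some n then ∑ v ∈ W, Phi p v else 0) := by
          refine Finset.sum_le_sum fun z _ => Finset.sum_le_sum fun n _ =>
            Finset.sum_le_sum fun m _ => ?_
          split_ifs with h
          · refine (expect_inter_le (fun e => (hpos e.1 e.2).le) (sum_prod_type_eq_one hsum)
              (fun x y => hlaw.true_pair_law n m x y h) W (perm z)).trans ?_
            change ∑ v ∈ W, Phi p v ≤ _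
            linarith
          · refine (expect_inter_le (f := fun e : A × B => margA p e.1 * margB p e.2)
              (fun e => (mul_pos (margA_pos hpos _) (margB_pos hpos _)).le)
              (sum_margA_mul_margB hsum)
              (fun x y => hlaw.random_pair_law n m x y h) W (perm z)).trans ?_
            simp only [Psi_eq_prod]
            linarith
      _ ≤ ∑ _z : Fin b, (N * M * ∑ v ∈ W, Psi p v + M * ∑ v ∈ W, Phi p v) := by
          refine Finset.sum_le_sum fun z _ => ?_
          simp only [Finset.sum_add_distrib]
          refine add_le_add (le_of_eq (by simp [mul_assoc])) ?_
          rw [Finset.sum_comm]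
          calc _ ≤ ∑ _m : Fin M, ∑ v ∈ W, Phi p v := by
                refine Finset.sum_le_sum fun m _ => ?_
                rcases h : partner m with _ | n
                · simpa using hPhi0
                · simp
            _ = _ := by simp
      _ = _ := by
          simp only [Finset.sum_const, Finset.card_univ, Fintype.card_fin, nsmul_eq_mul]
  have h1 := mul_le_mul_of_nonneg_left (add_le_add hA hB) c.insertion_nonneg
  have h2 := mul_le_mul_of_nonneg_left hAB c.pos_nonneg
  linarith

/-- The probability that a true pair is found when the bands use disjoint blocks of coordinates. -/
theorem prob_calledPositive_eq (hsum : ∑ i, ∑ j, p i j = 1) (hlaw : IsDataLaw p partner law)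
    {W : Finset (List (A × B))} {b d : ℕ} (hlen : ∀ v ∈ W, v.length ≤ d)
    (hW : ∀ v ∈ W, ∀ w ∈ W, v <+: w → v = w) (hd : d ≤ S) {j : Fin b × Fin d → Fin S}
    (hj : Function.Injective j) {perm : Fin b → Equiv.Perm (Fin S)}
    (hperm : ∀ z i, perm z (Fin.castLE hd i) = j (z, i)) {n : Fin N} {m : Fin M}
    (hnm : partner m = some n) :
    prob law {D | CalledPositive (W : Set (List (A × B))) perm (D.1 n) (D.2 m)} =
      1 - (1 - ∑ v ∈ W, Phi p v) ^ b := by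
  classical
  have hf1 : ∑ e : A × B, p e.1 e.2 = 1 := sum_prod_type_eq_one hsum
  have hprob : prob law {D | CalledPositive (W : Set (List (A × B))) perm (D.1 n) (D.2 m)} =
      ∑ D, law D * (if CalledPositive (W : Set (List (A × B))) perm (D.1 n) (D.2 m)
        then (1 : ℝ) else 0) := by
    rw [prob]
    refine Finset.sum_congr rfl fun D _ => ?_
    rw [Set.indicator_apply, mul_ite, mul_one, mul_zero]
    rfl
  rw [hprob, sum_law_pair (f := fun e => p e.1 e.2)
    (fun x y => hlaw.true_pair_law n m x y hnm) fun x y =>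
    if CalledPositive (W : Set (List (A × B))) perm x y then (1 : ℝ) else 0]
  -- All buckets have length at most `d`, so band `z` reads only its own block and missing in every
  -- band is a product over blocks.
  have hterm : ∀ w : Fin S → A × B,
      (if CalledPositive (W : Set (List (A × B))) perm (fun s => (w s).1) (fun s => (w s).2)
        then (1 : ℝ) else 0) =
      1 - ∏ z, (if ∃ v ∈ W, v <+: List.ofFn (fun i => w (j (z, i))) then (0 : ℝ) else 1) := by
    intro w
    have hiff : CalledPositive (W : Set (List (A × B))) perm (fun s => (w s).1)
        (fun s => (w s).2) ↔ ∃ z, ∃ v ∈ W, v <+: List.ofFn (fun i => w (j (z, i))) := by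
      refine exists_congr fun z => exists_congr fun v => ?_
      rw [mem_hashA_inter_hashB_iff]
      refine and_congr_right fun hv => ?_
      rw [prefix_ofFn_iff hd _ (hlen v hv)]
      simp only [hperm]
    simp only [hiff]
    split_ifs with h
    · obtain ⟨z, hz⟩ := h
      have h0 : ∏ z, (if ∃ v ∈ W, v <+: List.ofFn (fun i => w (j (z, i))) then (0 : ℝ) else 1) =
          0 := Finset.prod_eq_zero (Finset.mem_univ z) (if_pos hz)
      rw [h0, sub_zero]
    · have h1 : ∏ z, (if ∃ v ∈ W, v <+: List.ofFn (fun i => w (j (z, i))) then (0 : ℝ) else 1) =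
          1 := Finset.prod_eq_one fun z _ => if_neg fun hz => h ⟨z, hz⟩
      rw [h1, sub_self]
  simp only [hterm, mul_sub, mul_one, Finset.sum_sub_distrib]
  rw [sum_pi_prod fun _ (e : A × B) => p e.1 e.2, hf1, Finset.prod_const_one,
    sum_block_prod (f := fun e : A × B => p e.1 e.2) hf1 hj fun u =>
      if ∃ v ∈ W, v <+: List.ofFn u then (0 : ℝ) else 1, Fintype.card_fin]
  congr 2
  have h1 := sum_exists_prefix_eq hf1 hlen hW
  change _ = ∑ v ∈ W, Phi p v at h1
  have h2 : ∑ u : Fin d → A × B, ∏ i, p (u i).1 (u i).2 = 1 := by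
    rw [sum_pi_prod fun _ (e : A × B) => p e.1 e.2, hf1, Finset.prod_const_one]
  rw [eq_sub_iff_add_eq, ← h1, ← Finset.sum_add_distrib]
  refine (Finset.sum_congr rfl fun u _ => ?_).trans h2
  split_ifs <;> simp

end Hashing

/-! ### Perturbing the distribution -/

theorem prod_map_le_pow_mul {E : Type*} {f g : E → ℝ} {r : ℝ} (hr : 1 ≤ r)
    (hg : ∀ e, 0 ≤ g e) (hf : ∀ e, 0 ≤ f e) (hgf : ∀ e, g e ≤ r * f e) {d : ℕ} {v : List E}
    (hv : v.length ≤ d) : (v.map g).prod ≤ r ^ d * (v.map f).prod := by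
  have hnn : ∀ v : List E, 0 ≤ (v.map g).prod ∧ 0 ≤ (v.map f).prod := fun v => by
    constructor <;>
    · refine List.prod_nonneg fun x hx => ?_
      obtain ⟨y, -, rfl⟩ := List.mem_map.1 hx
      first | exact hg y | exact hf y
  have h : (v.map g).prod ≤ r ^ v.length * (v.map f).prod := by
    clear hv
    induction v with
    | nil => simp
    | cons e v ih =>
      simp only [List.map_cons, List.prod_cons, List.length_cons]
      have := mul_le_mul (hgf e) ih (hnn v).1 (mul_nonneg (by linarith) (hf e))
      calc _ ≤ _ := this
        _ = _ := by ring
  exact h.trans (mul_le_mul_of_nonneg_right (pow_le_pow_right₀ hr hv) (hnn v).2)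

theorem margA_le_mul {A B : Type*} [Fintype B] {p p' : A → B → ℝ} {r : ℝ}
    (h : ∀ i j, p' i j ≤ p i j * r) (i : A) :
    margA p' i ≤ r * margA p i := by
  rw [margA, margA, Finset.mul_sum]
  exact Finset.sum_le_sum fun j _ => by linarith [h i j]

theorem margB_le_mul {A B : Type*} [Fintype A] {p p' : A → B → ℝ} {r : ℝ}
    (h : ∀ i j, p' i j ≤ p i j * r) (j : B) :
    margB p' j ≤ r * margB p j := by
  rw [margB, margB, Finset.mul_sum]
  exact Finset.sum_le_sum fun i _ => by linarith [h i j]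

theorem Phi_le_pow_mul {A B : Type*} {p p' : A → B → ℝ} (hpos : ∀ i j, 0 < p i j)
    (hpos' : ∀ i j, 0 < p' i j) {r : ℝ} (hr : 1 ≤ r) (h : ∀ i j, p' i j ≤ p i j * r) {d : ℕ}
    {v : List (A × B)} (hv : v.length ≤ d) : Phi p' v ≤ r ^ d * Phi p v :=
  prod_map_le_pow_mul (f := fun e : A × B => p e.1 e.2) (g := fun e : A × B => p' e.1 e.2) hr
    (fun e => (hpos' e.1 e.2).le) (fun e => (hpos e.1 e.2).le)
    (fun e => (h e.1 e.2).trans_eq (mul_comm _ _)) hv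

theorem PsiA_le_pow_mul {A B : Type*} [Fintype B] [Nonempty B] {p p' : A → B → ℝ}
    (hpos : ∀ i j, 0 < p i j) (hpos' : ∀ i j, 0 < p' i j) {r : ℝ} (hr : 1 ≤ r) (h : ∀ i j, p' i j ≤ p i j * r) {d : ℕ}
    {v : List (A × B)} (hv : v.length ≤ d) : PsiA p' v ≤ r ^ d * PsiA p v :=
  prod_map_le_pow_mul (f := fun e : A × B => margA p e.1) (g := fun e : A × B => margA p' e.1) hr
    (fun e => (margA_pos hpos' e.1).le) (fun e => (margA_pos hpos e.1).le)
    (fun e => margA_le_mul h e.1) hv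

theorem PsiB_le_pow_mul {A B : Type*} [Fintype A] [Nonempty A] {p p' : A → B → ℝ}
    (hpos : ∀ i j, 0 < p i j) (hpos' : ∀ i j, 0 < p' i j) {r : ℝ} (hr : 1 ≤ r) (h : ∀ i j, p' i j ≤ p i j * r) {d : ℕ}
    {v : List (A × B)} (hv : v.length ≤ d) : PsiB p' v ≤ r ^ d * PsiB p v :=
  prod_map_le_pow_mul (f := fun e : A × B => margB p e.2) (g := fun e : A × B => margB p' e.2) hr
    (fun e => (margB_pos hpos' e.2).le) (fun e => (margB_pos hpos e.2).le)
    (fun e => margB_le_mul h e.2) hv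

/-- Only prefix-freeness is used, not the weights that built the tree, so the bound also serves `P'`
on the tree of `P`. -/
theorem bucket_mass_le_one [Nonempty A] [Nonempty B] {p : A → B → ℝ}
    (hpos : ∀ i j, 0 < p i j) (hsum : ∑ i, ∑ j, p i j = 1) {W : Finset (List (A × B))} {d : ℕ}
    (hlen : ∀ v ∈ W, v.length ≤ d) (hW : ∀ v ∈ W, ∀ w ∈ W, v <+: w → v = w) :
    ∑ v ∈ W, Phi p v ≤ 1 := by
  classical
  have hf1 := sum_prod_type_eq_one hsum
  have h1 := sum_exists_prefix_eq hf1 hlen hW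
  change _ = ∑ v ∈ W, Phi p v at h1
  rw [← h1]
  calc _ ≤ ∑ u : Fin d → A × B, ∏ i, p (u i).1 (u i).2 := by
        refine Finset.sum_le_sum fun u _ => ?_
        split_ifs
        · exact le_rfl
        · exact Finset.prod_nonneg fun i _ => (hpos _ _).le
    _ = 1 := by
        rw [sum_prod_word (fun e : A × B => p e.1 e.2), hf1, one_pow]

/-! ### Adding up the costs and choosing the number of bands -/

/-- The final bookkeeping: `R` bounds the distortion of node weights, `Q` is `N` to the power
`c_d log (1 + ε)` and `α` is the bucket mass. -/
theorem cost_bound {ct ch ci cp : ℝ} (hct : 0 ≤ ct) (hch : 0 ≤ ch) (hci : 0 ≤ ci) (hcp : 0 ≤ cp)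
    {N δ lam V b M R Q K₀ t α θ C₁ a' b' β' α' : ℝ} (hN : 1 ≤ N)
    (hlamδ : δ ≤ lam)
    (hV : V ≤ 2 / θ * N ^ lam) (hb0 : 0 ≤ b) (hb : b ≤ 2 * t * R / α) (hM0 : 0 ≤ M)
    (hM : M ≤ N ^ δ) (hR : 1 ≤ R) (hQ : 1 ≤ Q) (hRQ : R ≤ K₀ * Q) (ht : 0 ≤ t) (hα : 0 < α)
    (hθ : 0 < θ) (hC₁ : 0 < C₁) (hαlow : C₁ * N ^ (max 1 δ) ≤ α * (N ^ lam * Q ^ 2))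
    (ha' : a' ≤ R * (α * N ^ (lam - 1) / θ)) (hb' : b' ≤ R * (α * N ^ (lam - δ) / θ))
    (ha0 : 0 ≤ a') (hb0' : 0 ≤ b')
    (hβ' : β' ≤ R ^ 2 * (α * N ^ (lam - 1 - δ) / θ)) (hα' : α' ≤ R * α) :
    ct * V + ch * (b * N + b * M) + ci * (b * (N * a') + b * (M * b')) +
        cp * (b * (N * M * β' + M * α')) ≤
      (ct * (2 / θ) + ch * (4 * t * K₀ / C₁) + ci * (4 * t * K₀ ^ 2 / θ) +
        cp * (2 * t * K₀ ^ 3 * (1 / θ + 1))) * (N ^ lam * Q ^ 3) := by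
  have hN0 : 0 < N := by linarith
  have hK₀ : 0 ≤ K₀ := by
    by_contra h
    push Not at h
    nlinarith
  have hQ0 : 0 < Q := by linarith
  have hR0 : 0 < R := by linarith
  have hNl : 0 < N ^ lam := Real.rpow_pos_of_pos hN0 _
  have hQ13 : (1 : ℝ) ≤ Q ^ 3 := one_le_pow₀ hQ
  have hmul : ∀ x y : ℝ, N ^ x * N ^ y = N ^ (x + y) := fun x y => (Real.rpow_add hN0 x y).symm
  -- The insertion and positive-call terms contain `b` only together with a factor `α`, so no lower
  -- bound on the bucket mass is needed for them.
  have hbα : b * α ≤ 2 * t * R := (le_div_iff₀ hα).1 hb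
  have hNδ : 0 < N ^ δ := Real.rpow_pos_of_pos hN0 _
  have h1 : ct * V ≤ ct * (2 / θ) * (N ^ lam * Q ^ 3) := by
    rw [mul_assoc]
    refine mul_le_mul_of_nonneg_left (hV.trans ?_) hct
    refine mul_le_mul_of_nonneg_left ?_ (by positivity)
    exact le_mul_of_one_le_right hNl.le hQ13
  have hR2 : R ^ 2 ≤ K₀ ^ 2 * Q ^ 3 := by
    calc R ^ 2 ≤ (K₀ * Q) ^ 2 := pow_le_pow_left₀ hR0.le hRQ 2
      _ = K₀ ^ 2 * Q ^ 2 := by ring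
      _ ≤ _ := mul_le_mul_of_nonneg_left (pow_le_pow_right₀ hQ (by norm_num)) (by positivity)
  have hR3 : R ^ 3 ≤ K₀ ^ 3 * Q ^ 3 := by
    calc R ^ 3 ≤ (K₀ * Q) ^ 3 := pow_le_pow_left₀ hR0.le hRQ 3
      _ = _ := by ring
  -- Here `1 / α` is not compensated: the lower bound on the mass costs `Q ^ 2` and the factor `R`
  -- in `b` costs another `Q`.
  have h2 : ch * (b * N + b * M) ≤ ch * (4 * t * K₀ / C₁) * (N ^ lam * Q ^ 3) := by
    rw [mul_assoc]
    refine mul_le_mul_of_nonneg_left ?_ hch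
    have hNm : N ≤ N ^ (max 1 δ) := by
      conv_lhs => rw [← Real.rpow_one N]
      exact Real.rpow_le_rpow_of_exponent_le hN (le_max_left _ _)
    have hMm : M ≤ N ^ (max 1 δ) :=
      hM.trans (Real.rpow_le_rpow_of_exponent_le hN (le_max_right _ _))
    have hm : N ^ (max 1 δ) ≤ α * (N ^ lam * Q ^ 2) / C₁ := by
      rw [le_div_iff₀ hC₁]
      linarith
    calc b * N + b * M ≤ b * (2 * (α * (N ^ lam * Q ^ 2) / C₁)) := by
          rw [← mul_add]
          exact mul_le_mul_of_nonneg_left (by linarith) hb0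
      _ = (b * α) * (2 * (N ^ lam * Q ^ 2) / C₁) := by ring
      _ ≤ (2 * t * (K₀ * Q)) * (2 * (N ^ lam * Q ^ 2) / C₁) := by
          refine mul_le_mul_of_nonneg_right (hbα.trans ?_) (by positivity)
          exact mul_le_mul_of_nonneg_left hRQ (by positivity)
      _ = _ := by ring
  -- Shared by the insertions of classes (`z = N`) and of queries (`z = M`): one `R` from `b`, one
  -- from the distorted marginal.
  have hsum3 : ∀ x y : ℝ, 0 ≤ x → x ≤ R * (α * y / θ) → ∀ z : ℝ, 0 ≤ z → z * y ≤ N ^ lam →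
      b * (z * x) ≤ 2 * t * K₀ ^ 2 / θ * (N ^ lam * Q ^ 3) := by
    intro x y hx hxy z hz hzy
    calc b * (z * x) ≤ b * (z * (R * (α * y / θ))) :=
          mul_le_mul_of_nonneg_left (mul_le_mul_of_nonneg_left hxy hz) hb0
      _ = (b * α) * (R / θ * (z * y)) := by ring
      _ ≤ (b * α) * (R / θ * N ^ lam) :=
          mul_le_mul_of_nonneg_left (mul_le_mul_of_nonneg_left hzy (by positivity))
            (by positivity)
      _ ≤ (2 * t * R) * (R / θ * N ^ lam) := mul_le_mul_of_nonneg_right hbα (by positivity)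
      _ = 2 * t / θ * N ^ lam * R ^ 2 := by ring
      _ ≤ 2 * t / θ * N ^ lam * (K₀ ^ 2 * Q ^ 3) :=
          mul_le_mul_of_nonneg_left hR2 (by positivity)
      _ = _ := by ring
  have hNN : N * N ^ (lam - 1) ≤ N ^ lam := by
    conv_lhs => rw [← Real.rpow_one N, ← Real.rpow_mul hN0.le, one_mul, hmul]
    exact le_of_eq (by congr 1; ring)
  have hNM : ∀ x, M * N ^ (x - δ) ≤ N ^ x := fun x => by
    calc M * N ^ (x - δ) ≤ N ^ δ * N ^ (x - δ) :=
          mul_le_mul_of_nonneg_right hM (Real.rpow_pos_of_pos hN0 _).le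
      _ = N ^ x := by rw [hmul]; congr 1; ring
  have h3 : ci * (b * (N * a') + b * (M * b')) ≤
      ci * (4 * t * K₀ ^ 2 / θ) * (N ^ lam * Q ^ 3) := by
    rw [mul_assoc]
    refine mul_le_mul_of_nonneg_left ?_ hci
    have hA := hsum3 a' _ ha0 ha' N hN0.le hNN
    have hB := hsum3 b' _ hb0' hb' M hM0 (hNM lam)
    calc _ ≤ _ := add_le_add hA hB
      _ = _ := by ring
  have h4 : cp * (b * (N * M * β' + M * α')) ≤
      cp * (2 * t * K₀ ^ 3 * (1 / θ + 1)) * (N ^ lam * Q ^ 3) := by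
    rw [mul_assoc cp]
    refine mul_le_mul_of_nonneg_left ?_ hcp
    -- The `R ^ 2` comes from distorting both marginals; the factor `R` in `b` makes it `R ^ 3`.
    have hp1 : N * M * β' ≤ R ^ 2 * α / θ * N ^ lam := by
      calc N * M * β' ≤ N * M * (R ^ 2 * (α * N ^ (lam - 1 - δ) / θ)) :=
            mul_le_mul_of_nonneg_left hβ' (by positivity)
        _ = R ^ 2 * α / θ * (N * (M * N ^ (lam - 1 - δ))) := by ring
        _ ≤ R ^ 2 * α / θ * N ^ lam :=
            mul_le_mul_of_nonneg_left
              ((mul_le_mul_of_nonneg_left (hNM (lam - 1)) hN0.le).trans hNN) (by positivity)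
    have hp2 : M * α' ≤ R ^ 2 * α * N ^ lam := by
      calc M * α' ≤ M * (R * α) := mul_le_mul_of_nonneg_left hα' hM0
        _ ≤ N ^ lam * (R ^ 2 * α) := by
            refine mul_le_mul (hM.trans (Real.rpow_le_rpow_of_exponent_le hN hlamδ)) ?_
              (by positivity) hNl.le
            exact mul_le_mul_of_nonneg_right (by nlinarith) hα.le
        _ = _ := by ring
    calc b * (N * M * β' + M * α')
        ≤ b * (R ^ 2 * α / θ * N ^ lam + R ^ 2 * α * N ^ lam) :=
          mul_le_mul_of_nonneg_left (add_le_add hp1 hp2) hb0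
      _ = (b * α) * (R ^ 2 * (1 / θ + 1) * N ^ lam) := by ring
      _ ≤ (2 * t * R) * (R ^ 2 * (1 / θ + 1) * N ^ lam) :=
          mul_le_mul_of_nonneg_right hbα (by positivity)
      _ = 2 * t * (1 / θ + 1) * N ^ lam * R ^ 3 := by ring
      _ ≤ 2 * t * (1 / θ + 1) * N ^ lam * (K₀ ^ 3 * Q ^ 3) :=
          mul_le_mul_of_nonneg_left hR3 (by positivity)
      _ = _ := by ring
  linarith

/-- Enough independent bands of success probability `g` reach the true positive rate `TP`. -/
theorem le_one_sub_pow_of_bands {TP : ℝ} (hTP : TP < 1) {t x g : ℝ} (ht : -Real.log (1 - TP) ≤ t)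
    {b : ℕ} (hg1 : g ≤ 1) (hb : x ≤ b) (hxg : t ≤ x * g) (hg0 : 0 ≤ g) :
    TP ≤ 1 - (1 - g) ^ b := by
  have h1 : (1 - g) ^ b ≤ Real.exp (-t) := by
    calc (1 - g) ^ b ≤ Real.exp (-g) ^ b :=
          pow_le_pow_left₀ (by linarith) (Real.one_sub_le_exp_neg g) b
      _ = Real.exp (-(b * g)) := by
          rw [← Real.exp_nat_mul]
          congr 1
          ring
      _ ≤ Real.exp (-t) := by
          rw [Real.exp_le_exp]
          have := mul_le_mul_of_nonneg_right hb hg0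
          linarith
  have h2 : Real.exp (-t) ≤ 1 - TP := by
    rw [← Real.le_log_iff_exp_le (by linarith)]
    linarith
  linarith

end ForestDSH

end


/-! ### The noise robustness theorem -/

theorem theorem4 {A B : Type*} [Fintype A] [Fintype B] [Nontrivial A] [Nontrivial B]
    (p : A → B → ℝ) (hpos : ∀ i j, 0 < p i j) (hsum : ∑ i, ∑ j, p i j = 1)
    (δ : ℝ) (hδ : 0 ≤ δ) (ε : ℝ) (hε : 0 < ε) (TP : ℝ) (hTP : TP < 1)
    (c : ForestDSH.UnitCosts) :
    ∃ K : ℝ, ∀ N : ℕ, 2 ≤ N →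
      (ForestDSH.treeNodes p δ N).Finite ∧
      ∃ b : ℕ, ∀ S : ℕ, b * ForestDSH.treeDepth p δ N ≤ S →
        ∃ perm : Fin b → Equiv.Perm (Fin S),
          ∀ p' : A → B → ℝ, ∑ i, ∑ j, p' i j = 1 →
            (∀ i j, p i j / (1 + ε) ≤ p' i j ∧ p' i j ≤ p i j * (1 + ε)) →
            ∀ M : ℕ, (M : ℝ) ≤ (N : ℝ) ^ δ →
            ∀ (partner : Fin M → Option (Fin N)) (law : ForestDSH.DataSet A B S N M → ℝ),
              ForestDSH.IsDataLaw p' partner law →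
              (∀ n m, partner m = some n →
                TP ≤ ForestDSH.prob law
                  {D | ForestDSH.CalledPositive (ForestDSH.treeBuckets p δ N) perm
                    (D.1 n) (D.2 m)}) ∧
              ForestDSH.expect law
                  (ForestDSH.runCost c (ForestDSH.treeNodes p δ N)
                    (ForestDSH.treeBuckets p δ N) perm) ≤
                K * (N : ℝ) ^ (ForestDSH.lamStar p δ +
                  3 * ForestDSH.depthConst p δ * Real.log (1 + ε)) := by
  open ForestDSH in
  set r : ℝ := 1 + ε with hr
  have hr1 : 1 ≤ r := by linarith
  have hr0 : 0 < r := by linarith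
  have hlogr : 0 < Real.log r := Real.log_pos (by linarith)
  set lam : ℝ := lamStar p δ with hlam
  set cd : ℝ := depthConst p δ with hcd
  have hcd0 : 0 ≤ cd := depthConst_nonneg hpos hsum hδ
  have hlamδ : δ ≤ lam := (le_max_right 1 δ).trans (max_le_lamStar hsum hδ)
  -- Of the exponent `3 c_d log (1 + ε)`, one unit is reserved for `R`; the other two may be spent
  -- on the polynomial loss in the bucket mass.
  obtain ⟨C₁, hC₁, hmass⟩ := exists_bucket_mass_ge hpos hsum hδ
    (show 0 < 2 * Real.log r by positivity)
  -- The maximum with 1 makes `t R / α ≥ 1`, so rounding up at most doubles it and there is at least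
  -- one band.
  set t : ℝ := max 1 (-Real.log (1 - TP)) with ht
  have ht1 : 1 ≤ t := le_max_left _ _
  have hθ' : 0 < pZero p * qZero p := pZero_mul_qZero_pos hpos
  have hp0 := pZero_pos hpos
  have hp01 : pZero p ≤ 1 := by
    obtain ⟨i⟩ := (inferInstance : Nonempty A)
    obtain ⟨j⟩ := (inferInstance : Nonempty B)
    exact (pZero_le hpos hsum i j).trans (lt_one_of_pos hpos hsum i j).le
  set θ : ℝ := pZero p * (pZero p * qZero p) with hθdef
  have hθ : 0 < θ := mul_pos hp0 hθ'
  have hθle : θ ≤ pZero p * qZero p := mul_le_of_le_one_left hθ'.le hp01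
  -- This is `(1 + ε) ^ (depthSlack + 1)`, the part of the distortion that does not grow with `N`.
  set K₀ : ℝ := Real.exp ((depthSlack p + 1) * Real.log r) with hK₀
  refine ⟨c.tree * (2 / θ) + c.hash * (4 * t * K₀ / C₁) + c.insertion * (4 * t * K₀ ^ 2 / θ) +
    c.pos * (2 * t * K₀ ^ 3 * (1 / θ + 1)), fun N hN2 => ?_⟩
  have hN : 1 ≤ N := by omega
  have hN1 : (1 : ℝ) ≤ N := by exact_mod_cast hN
  have hN0 : (0 : ℝ) < N := by linarith
  have hfinV := treeNodes_finite hpos hsum hδ hN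
  refine ⟨hfinV, ?_⟩
  have hfinW : (treeBuckets p δ N).Finite := hfinV.subset fun v hv => bucket_mem_treeNodes hv
  set W : Finset (List (A × B)) := hfinW.toFinset with hWdef
  have hW : ∀ v, v ∈ W ↔ v ∈ treeBuckets p δ N := fun v => hfinW.mem_toFinset
  have hWcoe : treeBuckets p δ N = (W : Set (List (A × B))) := hfinW.coe_toFinset.symm
  set d : ℕ := treeDepth p δ N with hd
  have hlen : ∀ v ∈ W, v.length ≤ d := fun v hv =>
    length_le_treeDepth hpos hsum hδ hN (bucket_mem_treeNodes ((hW v).1 hv))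
  have hpre : ∀ v ∈ W, ∀ w ∈ W, v <+: w → v = w := fun v hv w hw h =>
    eq_of_leaf_prefix (bucket_not_branches ((hW v).1 hv)) (bucket_mem_treeNodes ((hW w).1 hw)) h
  set α : ℝ := ∑ v ∈ W, Phi p v with hα
  have hαlow : C₁ * (N : ℝ) ^ (max 1 δ - lam - cd * (2 * Real.log r)) ≤ α := hmass N hN W hW
  have hα0 : 0 < α := lt_of_lt_of_le (mul_pos hC₁ (Real.rpow_pos_of_pos hN0 _)) hαlow
  have hα1 : α ≤ 1 := bucket_mass_le_one hpos hsum hlen hpre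
  set R : ℝ := r ^ d with hR
  have hR1 : 1 ≤ R := one_le_pow₀ hr1
  have hR0 : 0 < R := by linarith
  set Q : ℝ := (N : ℝ) ^ (cd * Real.log r) with hQ
  have hQ1 : 1 ≤ Q := Real.one_le_rpow hN1 (mul_nonneg hcd0 hlogr.le)
  have hRQ : R ≤ K₀ * Q := by
    have h1 := treeDepth_le hpos hsum hδ hN
    rw [hR, ← Real.exp_log hr0, ← Real.exp_nat_mul, hK₀, hQ, Real.rpow_def_of_pos hN0,
      ← Real.exp_add, Real.exp_le_exp]
    have := mul_le_mul_of_nonneg_right h1 hlogr.le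
    linarith
  have hQpow : ∀ k : ℕ, Q ^ k = (N : ℝ) ^ (k * (cd * Real.log r)) := fun k => by
    rw [hQ, ← Real.rpow_natCast, ← Real.rpow_mul hN0.le]
    congr 1
    ring
  have hαlow' : C₁ * (N : ℝ) ^ (max 1 δ) ≤ α * ((N : ℝ) ^ lam * Q ^ 2) := by
    calc C₁ * (N : ℝ) ^ (max 1 δ) =
        C₁ * (N : ℝ) ^ (max 1 δ - lam - cd * (2 * Real.log r)) * ((N : ℝ) ^ lam * Q ^ 2) := by
          rw [hQpow, ← Real.rpow_add hN0, mul_assoc, ← Real.rpow_add hN0]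
          congr 2
          push_cast
          ring
      _ ≤ _ := mul_le_mul_of_nonneg_right hαlow (by positivity)
  -- Under any admissible `P'` the bucket mass is at least `α / R`, so this many bands give `b`
  -- times the mass at least `t`, with `b` chosen before `P'`.
  set b : ℕ := ⌈t * R / α⌉₊ with hb
  have hx1 : 1 ≤ t * R / α := by
    rw [le_div_iff₀ hα0, one_mul]
    nlinarith
  have hbge : t * R / α ≤ b := Nat.le_ceil _
  have hble : (b : ℝ) ≤ 2 * t * R / α := by
    have := (Nat.ceil_lt_add_one (by linarith : 0 ≤ t * R / α)).le
    calc (b : ℝ) ≤ t * R / α + t * R / α := by linarith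
      _ = _ := by ring
  have hb1 : 1 ≤ b := by
    have : (1 : ℝ) ≤ b := hx1.trans hbge
    exact_mod_cast this
  refine ⟨b, fun S hS => ?_⟩
  have hdS : d ≤ S := (Nat.le_mul_of_pos_left d hb1).trans hS
  obtain ⟨j, perm, hj, hperm⟩ := exists_block_perms hS hdS
  refine ⟨perm, fun p' hsum' hp' M hM partner law hlaw => ?_⟩
  have hpos' : ∀ i j, 0 < p' i j := fun i j => (div_pos (hpos i j) hr0).trans_le (hp' i j).1
  have hup : ∀ i j, p' i j ≤ p i j * r := fun i j => (hp' i j).2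
  have hlow : ∀ i j, p i j ≤ p' i j * r := fun i j => by
    have := (div_le_iff₀ hr0).1 (hp' i j).1
    linarith
  -- The lower bound on `P'` is the upper distortion bound with the roles of `p` and `p'` exchanged.
  have hα'low : α ≤ R * ∑ v ∈ W, Phi p' v := by
    rw [hα, Finset.mul_sum]
    exact Finset.sum_le_sum fun v hv => Phi_le_pow_mul hpos' hpos hr1 hlow (hlen v hv)
  have hα'up : ∑ v ∈ W, Phi p' v ≤ R * α := by
    rw [hα, Finset.mul_sum]
    exact Finset.sum_le_sum fun v hv => Phi_le_pow_mul hpos hpos' hr1 hup (hlen v hv)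
  rw [hWcoe]
  constructor
  · intro n m hnm
    rw [prob_calledPositive_eq hsum' hlaw hlen hpre hdS hj hperm hnm]
    refine le_one_sub_pow_of_bands hTP (t := t) (le_max_right _ _)
      (bucket_mass_le_one hpos' hsum' hlen hpre) hbge ?_ (Finset.sum_nonneg fun v _ => (Phi_pos hpos' v).le)
    calc t = t / α * α := by field_simp
      _ ≤ t / α * (R * ∑ v ∈ W, Phi p' v) :=
          mul_le_mul_of_nonneg_left hα'low (by positivity)
      _ = _ := by ring
  · have hcost := expect_runCost_le hpos' hsum' hlaw c (treeNodes p δ N) W perm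
    have hNexp : (N : ℝ) ^ (lam + 3 * cd * Real.log r) = (N : ℝ) ^ lam * Q ^ 3 := by
      rw [hQpow, ← Real.rpow_add hN0]
      congr 1
      push_cast
      ring
    -- Summed over the buckets, the nodewise inequalities bound a marginal mass by `α`. The general
    -- `x ≥ θ` covers both the constant `θ` of the pruning bounds and the constant `p₀ q₀` of
    -- acceptance.
    have hratio : ∀ (x : ℝ) (s : ℝ), 0 < x → θ ≤ x → ∀ y : ℝ, 0 ≤ s →
        x * (N : ℝ) ^ y * s ≤ α → s ≤ α * (N : ℝ) ^ (-y) / θ := by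
      intro x s hx hθx y hs h
      have hy : (0 : ℝ) < (N : ℝ) ^ y := Real.rpow_pos_of_pos hN0 _
      rw [Real.rpow_neg hN0.le, le_div_iff₀ hθ, ← div_eq_mul_inv, le_div_iff₀ hy]
      calc s * θ * (N : ℝ) ^ y = θ * ((N : ℝ) ^ y * s) := by ring
        _ ≤ x * ((N : ℝ) ^ y * s) := mul_le_mul_of_nonneg_right hθx (by positivity)
        _ ≤ α := by linarith
    have hA : ∑ v ∈ W, PsiA p' v ≤ R * (α * (N : ℝ) ^ (lam - 1) / θ) := by
      calc ∑ v ∈ W, PsiA p' v ≤ R * ∑ v ∈ W, PsiA p v := by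
            rw [Finset.mul_sum]
            exact Finset.sum_le_sum fun v hv =>
              PsiA_le_pow_mul hpos hpos' hr1 hup (hlen v hv)
        _ ≤ _ := by
            refine mul_le_mul_of_nonneg_left ?_ hR0.le
            rw [show lam - 1 = -(1 - lam) by ring]
            refine hratio θ _ hθ le_rfl _
              (Finset.sum_nonneg fun v _ => (PsiA_pos hpos v).le) ?_
            rw [Finset.mul_sum]
            exact Finset.sum_le_sum fun v hv => bucket_PsiA_le hpos hsum hδ hN ((hW v).1 hv)
    have hB : ∑ v ∈ W, PsiB p' v ≤ R * (α * (N : ℝ) ^ (lam - δ) / θ) := by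
      calc ∑ v ∈ W, PsiB p' v ≤ R * ∑ v ∈ W, PsiB p v := by
            rw [Finset.mul_sum]
            exact Finset.sum_le_sum fun v hv =>
              PsiB_le_pow_mul hpos hpos' hr1 hup (hlen v hv)
        _ ≤ _ := by
            refine mul_le_mul_of_nonneg_left ?_ hR0.le
            rw [show lam - δ = -(δ - lam) by ring]
            refine hratio θ _ hθ le_rfl _
              (Finset.sum_nonneg fun v _ => (PsiB_pos hpos v).le) ?_
            rw [Finset.mul_sum]
            exact Finset.sum_le_sum fun v hv => bucket_PsiB_le hpos hsum hδ hN ((hW v).1 hv)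
    have hPsi : ∑ v ∈ W, Psi p' v ≤ R ^ 2 * (α * (N : ℝ) ^ (lam - 1 - δ) / θ) := by
      calc ∑ v ∈ W, Psi p' v ≤ R ^ 2 * ∑ v ∈ W, Psi p v := by
            rw [Finset.mul_sum]
            refine Finset.sum_le_sum fun v hv => ?_
            have h1 : PsiA p' v ≤ R * PsiA p v :=
              PsiA_le_pow_mul hpos hpos' hr1 hup (hlen v hv)
            have h2 : PsiB p' v ≤ R * PsiB p v :=
              PsiB_le_pow_mul hpos hpos' hr1 hup (hlen v hv)
            calc Psi p' v ≤ (R * PsiA p v) * (R * PsiB p v) :=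
                  mul_le_mul h1 h2 (PsiB_pos hpos' v).le
                    (mul_nonneg hR0.le (PsiA_pos hpos v).le)
              _ = R ^ 2 * Psi p v := by rw [Psi]; ring
        _ ≤ _ := by
            refine mul_le_mul_of_nonneg_left ?_ (by positivity)
            rw [show lam - 1 - δ = -(1 + δ - lam) by ring]
            refine hratio (pZero p * qZero p) _ hθ' hθle _
              (Finset.sum_nonneg fun v _ =>
                (mul_pos (PsiA_pos hpos v) (PsiB_pos hpos v)).le) ?_
            rw [Finset.mul_sum]
            exact Finset.sum_le_sum fun v hv => bucket_Psi_le hpos ((hW v).1 hv)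
    rw [hNexp]
    refine hcost.trans ?_
    exact cost_bound c.tree_nonneg c.hash_nonneg c.insertion_nonneg c.pos_nonneg hN1 hlamδ
      (treeNodes_ncard_le hpos hsum hδ hN) (Nat.cast_nonneg b) hble (Nat.cast_nonneg M) hM hR1
      hQ1 hRQ (by linarith) hα0 hθ hC₁ hαlow' hA hB
      (Finset.sum_nonneg fun v _ => (PsiA_pos hpos' v).le)
      (Finset.sum_nonneg fun v _ => (PsiB_pos hpos' v).le) hPsi hα'up
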